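/- Let $d\ge 2$, $\mathbb T=\mathbb R/\mathbb Z$, let $\|t\|$ denote the distance from $t$ to the nearest integer, and equip $\mathbb T^d$ with Haar probability measure and the distance $|x-y|=\max_{1\le j\le d}\|x_j-y_j\|$. For $\gamma>0$ let $\mathrm{DC}(\mathbb T)_\gamma$ be the set of all $\omega\in\mathbb T$ such that $$\|k\omega\|\ \ge\ \frac{\gamma}{|k|\,\log^2(|k|+1)}\qquad\text{for all } k\in\mathbb Z\setminus\{0\}.$$ For $\omega\in\mathbb T$ let $S_\omega\colon\mathbb T^d\to\mathbb T^d$ be the affine skew product $$S_\omega(x_1,x_2,\dots,x_d)=(x_1+x_2,\;x_2+x_3,\;\dots,\;x_{d-1}+x_d,\;x_d+\omega).$$ For $0<\alpha\le 1$ let $C^\alpha(\mathbb T^d)$ be the space of $\alpha$-Hölder functions $\phi\colon\mathbb T^d\to\mathbb R$ with the norm $\|\phi\|_\alpha=\|\phi\|_\infty+\sup_{x\ne y}\frac{|\phi(x)-\phi(y)|}{|x-y|^\alpha}$. Put $\delta=2^{1-d}$. Then there are a sequence $\eta_N=\eta_N(d)\in\mathbb R$ with $\eta_N\to0$ as $N\to\infty$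 and, for every $\gamma>0$, a constant $C=C(d,\gamma)>0$ such that for all $\alpha\in(0,1]$, all $\phi\in C^\alpha(\mathbb T^d)$, all $\omega\in\mathrm{DC}(\mathbb T)_\gamma$ and all integers $N\ge1$, $$\Big\|\frac1N\sum_{j=0}^{N-1}\phi\circ S_\omega^j-\int_{\mathbb T^d}\phi\Big\|_\infty\ \le\ C\,\|\phi\|_\alpha\,N^{-\beta_N},\qquad \beta_N=\frac{\alpha\,\delta}{\delta+d}-\eta_N .$$ -/

import Mathlib

namespace SkewProduct

/-- The `d`-dimensional torus `(ℝ/ℤ)^d`. Its distance is the maximum over the coordinates of the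
distance in `ℝ/ℤ`, and its `volume` is the Haar probability measure. -/
abbrev Torus (d : ℕ) : Type := Fin d → UnitAddCircle

/-- The affine skew product
`(x₁, x₂, …, x_d) ↦ (x₁ + x₂, x₂ + x₃, …, x_{d-1} + x_d, x_d + ω)`. -/
def skewMap (d : ℕ) (ω : UnitAddCircle) (x : Torus d) : Torus d := fun i =>
  x i + if h : (i : ℕ) + 1 < d then x ⟨(i : ℕ) + 1, h⟩ else ω

/-- The frequencies `ω` with `‖kω‖ ≥ γ / (|k| log² (|k| + 1))` for every nonzero integer `k`.
The norm of `ℝ/ℤ` is the distance to the nearest integer. -/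
def DC (γ : ℝ) : Set UnitAddCircle :=
  {ω | ∀ k : ℤ, k ≠ 0 → γ / (|(k : ℝ)| * Real.log (|(k : ℝ)| + 1) ^ 2) ≤ ‖k • ω‖}

/-- The Hölder norm: the sup norm plus the Hölder seminorm (the least Hölder constant). -/
noncomputable def holderNorm {X : Type*} [MetricSpace X] [CompactSpace X] (α : NNReal)
    (φ : C(X, ℝ)) : ℝ :=
  ‖φ‖ + (nnHolderNorm α (φ : X → ℝ) : ℝ)

end SkewProduct

/-!
Along an orbit of the skew product the phase of a nonzero character `k` is a polynomial in the time
whose leading difference is the constant `k i • ω`, with `i` the first index at which `k i ≠ 0`.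
Weyl differencing turns the exponential sum into a sum of `min (N, 1 / ‖m k i ω‖)` over differencing
parameters `m`. By the divisor bound each multiple of `ω` arises from few of these parameters, and
by the Diophantine condition the multiples are well separated, so that up to a factor `N ^ ε` the
normalized exponential sum is at most `(‖k‖ / N) ^ δ`, whatever the degree. Approximating `φ` by its
convolution with a Jackson kernel of degree about `N ^ (δ / (δ + d))` yields the exponent
`α δ / (δ + d) - ε` for every `ε > 0`, and letting `ε` tend to `0` slowly with `N` gives `η`.
-/

namespace SkewProduct

open Finset Filter Topology fwdDiff
open AddCircle (toCircle)
open scoped ComplexConjugate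

section CircleGeometry

theorem exists_real_coe_eq_abs_eq_norm (x : UnitAddCircle) :
    ∃ t : ℝ, (t : UnitAddCircle) = x ∧ |t| = ‖x‖ := by
  induction x using QuotientAddGroup.induction_on with
  | H t =>
    refine ⟨t - round t, ?_, UnitAddCircle.norm_eq.symm⟩
    rw [AddCircle.coe_sub, sub_eq_self]
    exact (AddCircle.coe_eq_zero_iff (1 : ℝ)).2 ⟨round t, by simp⟩

theorem norm_le_half (x : UnitAddCircle) : ‖x‖ ≤ 1 / 2 := by
  simpa using AddCircle.norm_le_half_period 1 (x := x) one_ne_zero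

theorem four_mul_norm_le_norm_toCircle_sub_one (x : UnitAddCircle) :
    4 * ‖x‖ ≤ ‖(toCircle x : ℂ) - 1‖ := by
  obtain ⟨t, rfl, ht⟩ := exists_real_coe_eq_abs_eq_norm x
  have ht_half : |t| ≤ 1 / 2 := ht.trans_le (norm_le_half _)
  have hchord : ‖(toCircle (t : UnitAddCircle) : ℂ) - 1‖ = 2 * |Real.sin (Real.pi * t)| := by
    rw [AddCircle.toCircle_apply_mk, Circle.coe_exp, mul_comm _ Complex.I,
      Complex.norm_exp_I_mul_ofReal_sub_one, Real.norm_eq_abs, abs_mul, abs_two]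
    congr 3
    ring
  have habs : |Real.pi * t| = Real.pi * |t| := by rw [abs_mul, abs_of_pos Real.pi_pos]
  have hjordan : 2 / Real.pi * |Real.pi * t| ≤ |Real.sin (Real.pi * t)| := by
    refine Real.mul_abs_le_abs_sin ?_
    rw [habs]
    nlinarith [Real.pi_pos]
  have hscale : 2 / Real.pi * |Real.pi * t| = 2 * |t| := by
    rw [habs]
    field_simp
  rw [hchord, ← ht]
  linarith

end CircleGeometry

section PolynomialPhases

variable {G : Type*} [AddCommGroup G]

theorem eq_add_nsmul_of_fwdDiff_eq_const {f : ℕ → G} {c : G} (hf : Δ_[1] f = fun _ => c) (n : ℕ) :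
    f n = f 0 + n • c := by
  induction n with
  | zero => simp
  | succ n ih =>
    rw [succ_nsmul, ← add_assoc, ← ih, ← congrFun hf n, fwdDiff, add_sub_cancel]

theorem fwdDiff_commute (h k : ℕ) :
    Function.Commute (fwdDiff h : (ℕ → G) → ℕ → G) (fwdDiff k) := by
  intro f
  funext n
  simp only [fwdDiff, add_right_comm n k h]
  abel

theorem fwdDiff_iter_fwdDiff_eq_const {f : ℕ → G} {c : G} {D : ℕ}
    (hf : (Δ_[1])^[D + 1] f = fun _ => c) (h : ℕ) : (Δ_[1])^[D] (Δ_[h] f) = fun _ => h • c := by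
  have hcomm : (Δ_[1])^[D] (Δ_[h] f) = Δ_[h] ((Δ_[1])^[D] f) :=
    (fwdDiff_commute 1 h).iterate_left D f
  rw [Function.iterate_succ_apply'] at hf
  rw [hcomm]
  funext n
  simp only [fwdDiff, eq_add_nsmul_of_fwdDiff_eq_const hf (n + h),
    eq_add_nsmul_of_fwdDiff_eq_const hf n, add_nsmul]
  abel

end PolynomialPhases

section WeylDifferencing

/-- The majorant `min N (1 / (2 ‖c‖))` of the geometric sums `∑_{n < M} e(nc)` with `M ≤ N`, in a
form that has the value `N` at `c = 0`. -/
noncomputable def linearMajorant (N : ℕ) (c : UnitAddCircle) : ℝ := N / max 1 (2 * N * ‖c‖)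

/-- The sum of `linearMajorant N (h₁ ⋯ h_j c)` over all `0 ≤ h₁, …, h_j < N`; it bounds exponential
sums along phases of degree `j + 1` after `j` Weyl differencing steps. -/
noncomputable def weylMajorant : ℕ → ℕ → UnitAddCircle → ℝ
  | 0, N, c => linearMajorant N c
  | j + 1, N, c => ∑ h ∈ range N, weylMajorant j N (h • c)

theorem linearMajorant_nonneg (N : ℕ) (c : UnitAddCircle) : 0 ≤ linearMajorant N c := by
  unfold linearMajorant; positivity

theorem linearMajorant_le (N : ℕ) (c : UnitAddCircle) : linearMajorant N c ≤ N :=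
  div_le_self (Nat.cast_nonneg N) (le_max_left _ _)

theorem weylMajorant_nonneg (j N : ℕ) (c : UnitAddCircle) : 0 ≤ weylMajorant j N c := by
  induction j generalizing c with
  | zero => exact linearMajorant_nonneg N c
  | succ j ih => exact sum_nonneg fun h _ => ih _

theorem weylMajorant_le_pow (j N : ℕ) (c : UnitAddCircle) :
    weylMajorant j N c ≤ (N : ℝ) ^ (j + 1) := by
  induction j generalizing c with
  | zero => simpa [weylMajorant] using linearMajorant_le N c
  | succ j ih =>
    calc weylMajorant (j + 1) N c ≤ ∑ _h ∈ range N, (N : ℝ) ^ (j + 1) := sum_le_sum fun h _ => ih _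
      _ = (N : ℝ) ^ (j + 1 + 1) := by rw [sum_const, card_range, nsmul_eq_mul]; ring

theorem norm_geom_sum_toCircle_le {M N : ℕ} (hMN : M ≤ N) (c : UnitAddCircle) :
    ‖∑ n ∈ range M, (toCircle c : ℂ) ^ n‖ ≤ linearMajorant N c := by
  have hcard : ‖∑ n ∈ range M, (toCircle c : ℂ) ^ n‖ ≤ N := by
    refine (norm_sum_le _ _).trans ?_
    simpa [Circle.norm_coe] using hMN
  have hgeom : ‖∑ n ∈ range M, (toCircle c : ℂ) ^ n‖ * (2 * ‖c‖) ≤ 1 := by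
    have hmul := congrArg norm (geom_sum_mul (toCircle c : ℂ) M)
    have htwo : ‖(toCircle c : ℂ) ^ M - 1‖ ≤ 2 := by
      refine (norm_sub_le _ _).trans ?_
      rw [norm_pow, Circle.norm_coe, norm_one, one_pow, one_add_one_eq_two]
    rw [norm_mul] at hmul
    have := mul_le_mul_of_nonneg_left (four_mul_norm_le_norm_toCircle_sub_one c)
      (norm_nonneg (∑ n ∈ range M, (toCircle c : ℂ) ^ n))
    linarith
  rw [linearMajorant, le_div_iff₀ (by positivity), mul_max_of_nonneg _ _ (norm_nonneg _)]
  refine max_le (by simpa using hcard) ?_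
  nlinarith [Nat.cast_nonneg (α := ℝ) N]

theorem norm_sum_toCircle_le_linearMajorant {c : UnitAddCircle} {f : ℕ → UnitAddCircle}
    (hf : Δ_[1] f = fun _ => c) {M N : ℕ} (hMN : M ≤ N) :
    ‖∑ n ∈ range M, (toCircle (f n) : ℂ)‖ ≤ linearMajorant N c := by
  have hfactor : ∑ n ∈ range M, (toCircle (f n) : ℂ)
      = toCircle (f 0) * ∑ n ∈ range M, (toCircle c : ℂ) ^ n := by
    rw [mul_sum]
    refine sum_congr rfl fun n _ => ?_
    rw [eq_add_nsmul_of_fwdDiff_eq_const hf, AddCircle.toCircle_add, AddCircle.toCircle_nsmul,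
      Circle.coe_mul, Circle.coe_pow]
  rw [hfactor, norm_mul, Circle.norm_coe, one_mul]
  exact norm_geom_sum_toCircle_le hMN c

theorem normSq_sum_range_le (z : ℕ → ℂ) (M : ℕ) :
    Complex.normSq (∑ n ∈ range M, z n)
      ≤ 2 * (∑ m ∈ range M, z m * conj (∑ n ∈ range (m + 1), z n)).re := by
  induction M with
  | zero => simp
  | succ M ih =>
    have hlast : z M * conj (∑ n ∈ range (M + 1), z n)
        = z M * conj (∑ n ∈ range M, z n) + (Complex.normSq (z M) : ℂ) := by
      rw [sum_range_succ, map_add, mul_add, Complex.mul_conj]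
    have hsymm : (z M * conj (∑ n ∈ range M, z n)).re
        = ((∑ n ∈ range M, z n) * conj (z M)).re := by
      simp only [Complex.mul_re, Complex.conj_re, Complex.conj_im]; ring
    rw [sum_range_succ _ M, sum_range_succ _ M, Complex.add_re, Complex.normSq_add, hlast,
      Complex.add_re, Complex.ofReal_re, hsymm]
    linarith [Complex.normSq_nonneg (z M)]

theorem norm_sq_sum_range_le_sum_correlations (z : ℕ → ℂ) (M : ℕ) :
    ‖∑ n ∈ range M, z n‖ ^ 2
      ≤ 2 * ∑ h ∈ range M, ‖∑ n ∈ range (M - h), z (n + h) * conj (z n)‖ := by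
  have hflip : ∑ m ∈ range M, z m * conj (∑ n ∈ range (m + 1), z n)
      = ∑ h ∈ range M, ∑ n ∈ range (M - h), z (n + h) * conj (z n) := by
    rw [← sum_range_diag_flip M fun h n => z (n + h) * conj (z n)]
    refine sum_congr rfl fun m _ => ?_
    rw [map_sum, mul_sum, ← sum_range_reflect]
    refine sum_congr rfl fun k hk => ?_
    rw [mem_range] at hk
    rw [show m - k + k = m by omega, show m + 1 - 1 - k = m - k by omega]
  rw [← Complex.normSq_eq_norm_sq]
  refine (normSq_sum_range_le z M).trans ?_
  rw [hflip]
  gcongr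
  exact (Complex.re_le_norm _).trans (norm_sum_le _ _)

theorem norm_sq_sum_toCircle_le {M N : ℕ} (hMN : M ≤ N) (f : ℕ → UnitAddCircle) :
    ‖∑ n ∈ range M, (toCircle (f n) : ℂ)‖ ^ 2
      ≤ 2 * ∑ h ∈ range N, ‖∑ n ∈ range (M - h), (toCircle (Δ_[h] f n) : ℂ)‖ := by
  refine (norm_sq_sum_range_le_sum_correlations _ M).trans ?_
  gcongr
  refine le_trans (le_of_eq (sum_congr rfl fun h _ => ?_))
    (sum_le_sum_of_subset_of_nonneg (range_mono hMN) fun h _ _ => norm_nonneg _)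
  simp only [fwdDiff, sub_eq_add_neg, AddCircle.toCircle_add, AddCircle.toCircle_neg,
    Circle.coe_mul, Circle.coe_inv_eq_conj]

theorem sum_range_pow_mul_le {p : ℕ} (hp : p ≠ 0) {a : ℕ → ℝ} (ha : ∀ h, 0 ≤ a h) (N : ℕ) :
    (∑ h ∈ range N, a h) ^ p * N ≤ (N : ℝ) ^ p * ∑ h ∈ range N, a h ^ p := by
  obtain ⟨q, rfl⟩ := Nat.exists_eq_succ_of_ne_zero hp
  have hmean := pow_sum_le_card_mul_sum_pow (s := range N) (fun h _ => ha h) q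
  rw [card_range] at hmean
  calc (∑ h ∈ range N, a h) ^ (q + 1) * N
      ≤ ((N : ℝ) ^ q * ∑ h ∈ range N, a h ^ (q + 1)) * N := by gcongr
    _ = (N : ℝ) ^ (q + 1) * ∑ h ∈ range N, a h ^ (q + 1) := by ring

theorem norm_sum_toCircle_pow_le_weylMajorant (j : ℕ) {c : UnitAddCircle} {f : ℕ → UnitAddCircle}
    (hf : (Δ_[1])^[j + 1] f = fun _ => c) {M N : ℕ} (hMN : M ≤ N) :
    ‖∑ n ∈ range M, (toCircle (f n) : ℂ)‖ ^ 2 ^ j * (N : ℝ) ^ (j + 1)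
      ≤ 2 ^ 2 ^ j * (N : ℝ) ^ 2 ^ j * weylMajorant j N c := by
  induction j generalizing c f M with
  | zero =>
    simp only [pow_zero, pow_one, zero_add, weylMajorant]
    have hlin := mul_le_mul_of_nonneg_right (norm_sum_toCircle_le_linearMajorant hf hMN)
      (Nat.cast_nonneg (α := ℝ) N)
    linarith [mul_nonneg (Nat.cast_nonneg (α := ℝ) N) (linearMajorant_nonneg N c)]
  | succ j ih =>
    set S : ℕ → ℝ := fun h => ‖∑ n ∈ range (M - h), (toCircle (Δ_[h] f n) : ℂ)‖
    have hS : ∀ h, S h ^ 2 ^ j * (N : ℝ) ^ (j + 1)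
        ≤ 2 ^ 2 ^ j * (N : ℝ) ^ 2 ^ j * weylMajorant j N (h • c) := fun h =>
      ih (fwdDiff_iter_fwdDiff_eq_const hf h) ((Nat.sub_le _ _).trans hMN)
    have hmean := sum_range_pow_mul_le (p := 2 ^ j) (by positivity) (a := S)
      (fun h => norm_nonneg _) N
    calc ‖∑ n ∈ range M, (toCircle (f n) : ℂ)‖ ^ 2 ^ (j + 1) * (N : ℝ) ^ (j + 2)
        = (‖∑ n ∈ range M, (toCircle (f n) : ℂ)‖ ^ 2) ^ 2 ^ j * (N : ℝ) ^ (j + 2) := by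
          rw [← pow_mul, pow_succ' 2 j]
      _ ≤ (2 * ∑ h ∈ range N, S h) ^ 2 ^ j * (N : ℝ) ^ (j + 2) := by
          gcongr
          exact norm_sq_sum_toCircle_le hMN f
      _ = 2 ^ 2 ^ j * ((∑ h ∈ range N, S h) ^ 2 ^ j * N) * (N : ℝ) ^ (j + 1) := by
          rw [mul_pow]; ring
      _ ≤ 2 ^ 2 ^ j * ((N : ℝ) ^ 2 ^ j * ∑ h ∈ range N, S h ^ 2 ^ j) * (N : ℝ) ^ (j + 1) := by
          gcongr
      _ = 2 ^ 2 ^ j * (N : ℝ) ^ 2 ^ j * ∑ h ∈ range N, S h ^ 2 ^ j * (N : ℝ) ^ (j + 1) := by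
          rw [← sum_mul]; ring
      _ ≤ 2 ^ 2 ^ j * (N : ℝ) ^ 2 ^ j *
          ∑ h ∈ range N, 2 ^ 2 ^ j * (N : ℝ) ^ 2 ^ j * weylMajorant j N (h • c) := by
          refine mul_le_mul_of_nonneg_left (sum_le_sum fun h _ => hS h) (by positivity)
      _ = 2 ^ 2 ^ (j + 1) * (N : ℝ) ^ 2 ^ (j + 1) * weylMajorant (j + 1) N c := by
          rw [← mul_sum, weylMajorant, pow_succ' 2 j, two_mul, pow_add, pow_add]; ring

end WeylDifferencing

section DivisorBound

theorem exists_one_add_natCast_le_mul_rpow {ε : ℝ} (hε : 0 < ε) :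
    ∃ A : ℝ, 1 ≤ A ∧ ∀ (a : ℕ) (p : ℝ), 2 ≤ p → 1 + (a : ℝ) ≤ A * (p ^ a) ^ ε := by
  have hlog : 0 < Real.log 2 := Real.log_pos one_lt_two
  set A := max 1 (1 / (ε * Real.log 2))
  have hA : 1 ≤ A := le_max_left _ _
  have hAlog : 1 ≤ A * (ε * Real.log 2) :=
    (div_le_iff₀ (by positivity)).1 (le_max_right _ _)
  refine ⟨A, hA, fun a p hp => ?_⟩
  have hexp : 1 + ε * Real.log 2 * a ≤ ((2 : ℝ) ^ a) ^ ε := by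
    rw [← Real.rpow_natCast, ← Real.rpow_mul zero_le_two, Real.rpow_def_of_pos two_pos, add_comm]
    exact (Real.add_one_le_exp _).trans_eq (by ring_nf)
  calc 1 + (a : ℝ) ≤ A + A * (ε * Real.log 2) * a := by
        gcongr; exact le_mul_of_one_le_left (by positivity) hAlog
    _ = A * (1 + ε * Real.log 2 * a) := by ring
    _ ≤ A * ((2 : ℝ) ^ a) ^ ε := by gcongr
    _ ≤ A * (p ^ a) ^ ε := by gcongr

theorem one_add_natCast_le_rpow {ε p : ℝ} (hp : 0 ≤ p) (hpε : 2 ≤ p ^ ε) (a : ℕ) :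
    1 + (a : ℝ) ≤ (p ^ a) ^ ε := by
  have htwo : 1 + a ≤ 2 ^ a := by rw [add_comm]; exact Nat.lt_two_pow_self
  calc 1 + (a : ℝ) ≤ 2 ^ a := by exact_mod_cast htwo
    _ ≤ (p ^ ε) ^ a := by gcongr
    _ = (p ^ a) ^ ε := by
      rw [← Real.rpow_natCast, ← Real.rpow_natCast, ← Real.rpow_mul hp, ← Real.rpow_mul hp,
        mul_comm]

theorem natCast_rpow_eq_prod_primeFactors {n : ℕ} (hn : n ≠ 0) (ε : ℝ) :
    (n : ℝ) ^ ε = ∏ p ∈ n.primeFactors, ((p : ℝ) ^ n.factorization p) ^ ε := by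
  rw [Real.finsetProd_rpow _ _ fun p _ => by positivity]
  congr 1
  exact_mod_cast (Nat.prod_factorization_pow_eq_self hn).symm

theorem exists_card_divisors_le_mul_rpow {ε : ℝ} (hε : 0 < ε) :
    ∃ C : ℝ, 1 ≤ C ∧ ∀ n : ℕ, n ≠ 0 → (#n.divisors : ℝ) ≤ C * (n : ℝ) ^ ε := by
  obtain ⟨A, hA, hA_small⟩ := exists_one_add_natCast_le_mul_rpow hε
  set P := ⌈(2 : ℝ) ^ (1 / ε)⌉₊
  refine ⟨A ^ P, one_le_pow₀ hA, fun n hn => ?_⟩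
  have hlocal : ∀ p ∈ n.primeFactors, (n.factorization p : ℝ) + 1
      ≤ (if p < P then A else 1) * ((p : ℝ) ^ n.factorization p) ^ ε := by
    intro p hp
    rw [add_comm]
    split_ifs with hpP
    · exact hA_small _ _ (by exact_mod_cast (Nat.prime_of_mem_primeFactors hp).two_le)
    · rw [one_mul]
      refine one_add_natCast_le_rpow p.cast_nonneg ?_ _
      calc (2 : ℝ) = ((2 : ℝ) ^ (1 / ε)) ^ ε := by
            rw [← Real.rpow_mul zero_le_two, one_div_mul_cancel hε.ne', Real.rpow_one]
        _ ≤ (p : ℝ) ^ ε := by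
            gcongr
            exact (Nat.le_ceil _).trans (by exact_mod_cast not_lt.1 hpP)
  have hconst : ∏ p ∈ n.primeFactors, (if p < P then A else 1) ≤ A ^ P := by
    rw [prod_ite, prod_const_one, mul_one, prod_const]
    refine pow_le_pow_right₀ hA ((card_le_card (t := range P) fun p hp => ?_).trans_eq
      (card_range P))
    simpa using (mem_filter.1 hp).2
  rw [Nat.card_divisors hn, natCast_rpow_eq_prod_primeFactors hn]
  push_cast
  refine (prod_le_prod (fun _ _ => by positivity) hlocal).trans ?_
  rw [prod_mul_distrib]
  gcongr

theorem card_filter_mul_eq_le_card_divisors (N M : ℕ) {l : ℕ} (hl : l ≠ 0) :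
    #{p ∈ Icc 1 N ×ˢ Icc 1 M | p.1 * p.2 = l} ≤ #l.divisors := by
  refine card_le_card_of_injOn Prod.fst (fun p hp => ?_) fun p hp q hq hpq => ?_
  · exact Nat.mem_divisors.2 ⟨⟨p.2, (mem_filter.1 hp).2.symm⟩, hl⟩
  · have hp := mem_filter.1 hp
    have hq := mem_filter.1 hq
    have hpos : 0 < p.1 := (mem_Icc.1 (mem_product.1 hp.1).1).1
    refine Prod.ext hpq (Nat.eq_of_mul_eq_mul_left hpos ?_)
    rw [hp.2, hpq, hq.2]

theorem sum_sum_mul_le_of_card_divisors_le {g : ℕ → ℝ} (hg : ∀ n, 0 ≤ g n) {B : ℝ} {N M : ℕ}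
    (hB : ∀ l ∈ Icc 1 (N * M), (#l.divisors : ℝ) ≤ B) :
    ∑ h ∈ Icc 1 N, ∑ m ∈ Icc 1 M, g (h * m) ≤ B * ∑ l ∈ Icc 1 (N * M), g l := by
  have hmaps : ∀ p ∈ Icc 1 N ×ˢ Icc 1 M, p.1 * p.2 ∈ Icc 1 (N * M) := by
    intro p hp
    simp only [mem_product, mem_Icc] at hp ⊢
    exact ⟨Nat.mul_pos hp.1.1 hp.2.1, Nat.mul_le_mul hp.1.2 hp.2.2⟩
  rw [← sum_product' (f := fun h m => g (h * m)), ← sum_fiberwise_of_maps_to hmaps, mul_sum]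
  refine sum_le_sum fun l hl => ?_
  have hfiber : ∑ p ∈ Icc 1 N ×ˢ Icc 1 M with p.1 * p.2 = l, g (p.1 * p.2)
      = #{p ∈ Icc 1 N ×ˢ Icc 1 M | p.1 * p.2 = l} * g l := by
    rw [← nsmul_eq_mul, ← sum_const]
    exact sum_congr rfl fun p hp => by rw [(mem_filter.1 hp).2]
  rw [hfiber]
  refine mul_le_mul_of_nonneg_right (le_trans ?_ (hB l hl)) (hg l)
  exact_mod_cast card_filter_mul_eq_le_card_divisors N M (Nat.one_le_iff_ne_zero.1 (mem_Icc.1 hl).1)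

theorem weylMajorant_succ_le (j N : ℕ) (c : UnitAddCircle) :
    weylMajorant (j + 1) N c ≤ (N : ℝ) ^ (j + 1) + ∑ h ∈ Icc 1 N, weylMajorant j N (h • c) := by
  have hsub : range N ⊆ insert 0 (Icc 1 N) := fun h hh => by
    simp only [mem_insert, mem_Icc, mem_range] at hh ⊢; omega
  calc weylMajorant (j + 1) N c
      ≤ ∑ h ∈ insert 0 (Icc 1 N), weylMajorant j N (h • c) :=
        sum_le_sum_of_subset_of_nonneg hsub fun h _ _ => weylMajorant_nonneg _ _ _
    _ = weylMajorant j N (0 • c) + ∑ h ∈ Icc 1 N, weylMajorant j N (h • c) :=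
        sum_insert (by simp)
    _ ≤ (N : ℝ) ^ (j + 1) + ∑ h ∈ Icc 1 N, weylMajorant j N (h • c) := by
        gcongr
        exact weylMajorant_le_pow _ _ _

theorem weylMajorant_le_sum_linearMajorant {N D : ℕ} {B : ℝ} (hB0 : 0 ≤ B)
    (hB : ∀ l ∈ Icc 1 (N ^ D), (#l.divisors : ℝ) ≤ B) (hN : 1 ≤ N) {j : ℕ} (hj : j ≤ D)
    (c : UnitAddCircle) :
    weylMajorant j N c ≤ j * (N : ℝ) ^ j +
      B ^ j * ∑ m ∈ Icc 1 (N ^ j), linearMajorant N (m • c) := by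
  induction j generalizing c with
  | zero => simp [weylMajorant]
  | succ j ih =>
    have hdiv : ∀ l ∈ Icc 1 (N * N ^ j), (#l.divisors : ℝ) ≤ B := fun l hl => by
      rw [← pow_succ'] at hl
      exact hB l (Icc_subset_Icc_right (Nat.pow_le_pow_right hN hj) hl)
    have hfold := sum_sum_mul_le_of_card_divisors_le (g := fun l => linearMajorant N (l • c))
      (fun l => linearMajorant_nonneg _ _) hdiv
    calc weylMajorant (j + 1) N c
        ≤ (N : ℝ) ^ (j + 1) + ∑ h ∈ Icc 1 N, weylMajorant j N (h • c) :=
          weylMajorant_succ_le j N c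
      _ ≤ (N : ℝ) ^ (j + 1) + ∑ h ∈ Icc 1 N, (j * (N : ℝ) ^ j +
            B ^ j * ∑ m ∈ Icc 1 (N ^ j), linearMajorant N (m • h • c)) := by
          gcongr with h
          exact ih (by omega) (h • c)
      _ = (j + 1 : ℕ) * (N : ℝ) ^ (j + 1) + B ^ j *
            ∑ h ∈ Icc 1 N, ∑ m ∈ Icc 1 (N ^ j), linearMajorant N ((h * m) • c) := by
          simp only [smul_smul, mul_comm _ (_ : ℕ)]
          rw [sum_add_distrib, sum_const, Nat.card_Icc, nsmul_eq_mul, ← mul_sum]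
          push_cast [Nat.add_sub_cancel]
          ring
      _ ≤ (j + 1 : ℕ) * (N : ℝ) ^ (j + 1) + B ^ j *
            (B * ∑ l ∈ Icc 1 (N * N ^ j), linearMajorant N (l • c)) := by gcongr
      _ = (j + 1 : ℕ) * (N : ℝ) ^ (j + 1) + B ^ (j + 1) *
            ∑ l ∈ Icc 1 (N ^ (j + 1)), linearMajorant N (l • c) := by
          rw [pow_succ B, pow_succ' N, mul_assoc (B ^ j)]

end DivisorBound

section SeparatedPoints

theorem injOn_floor_div_of_pairwise {ι : Type*} {A : Set ι} {u : ι → ℝ} {s : ℝ} (hs : 0 < s)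
    (hu : ∀ i ∈ A, 0 ≤ u i) (hsep : A.Pairwise fun i j => s ≤ |u i - u j|) :
    Set.InjOn (fun i => ⌊u i / s⌋₊) A := by
  intro i hi j hj hij
  by_contra hne
  have hfloor : ⌊u i / s⌋ = ⌊u j / s⌋ := by
    rw [← Int.natCast_floor_eq_floor (div_nonneg (hu i hi) hs.le),
      ← Int.natCast_floor_eq_floor (div_nonneg (hu j hj) hs.le)]
    exact congrArg _ hij
  have hlt := Int.abs_sub_lt_one_of_floor_eq_floor hfloor
  rw [← sub_div, abs_div, abs_of_pos hs, div_lt_one hs] at hlt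
  exact hlt.not_ge (hsep hi hj hne)

theorem div_max_le_of_floor_div_ne_zero {N s u : ℝ} (hN : 0 ≤ N) (hs : 0 < s) (hu : 0 ≤ u)
    (hfloor : ⌊u / s⌋₊ ≠ 0) :
    N / max 1 (2 * N * u) ≤ 1 / (2 * s) * (⌊u / s⌋₊ : ℝ)⁻¹ := by
  have hle : (⌊u / s⌋₊ : ℝ) * s ≤ u := by
    rw [← le_div_iff₀ hs]; exact Nat.floor_le (by positivity)
  have hpos : (0 : ℝ) < ⌊u / s⌋₊ := by exact_mod_cast Nat.pos_of_ne_zero hfloor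
  rw [← one_div, one_div_mul_one_div, div_le_div_iff₀ (by positivity) (by positivity), one_mul]
  refine le_trans ?_ (le_max_right _ _)
  nlinarith

theorem harmonic_floor_le {x : ℝ} (hx : 1 ≤ x) : (harmonic ⌊x⌋₊ : ℝ) ≤ 1 + Real.log x := by
  refine (harmonic_le_one_add_log _).trans ?_
  gcongr
  · exact_mod_cast Nat.floor_pos.2 hx
  · exact Nat.floor_le (by positivity)

theorem sum_div_max_le_of_pairwise {ι : Type*} {A : Finset ι} {u : ι → ℝ} {s N : ℝ}
    (hN : 0 ≤ N) (hs : 0 < s) (hs1 : s ≤ 1) (hu0 : ∀ i ∈ A, 0 ≤ u i) (hu1 : ∀ i ∈ A, u i ≤ 1)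
    (hsep : (A : Set ι).Pairwise fun i j => s ≤ |u i - u j|) :
    ∑ i ∈ A, N / max 1 (2 * N * u i) ≤ N + 1 / (2 * s) * (1 + Real.log (1 / s)) := by
  set F : ℕ → ℝ := fun r => if r = 0 then N else 1 / (2 * s) * (r : ℝ)⁻¹ with hF
  have hF0 : ∀ r, 0 ≤ F r := fun r => by simp only [hF]; split_ifs <;> positivity
  have hle : ∀ i ∈ A, N / max 1 (2 * N * u i) ≤ F ⌊u i / s⌋₊ := by
    intro i hi
    simp only [hF]
    split_ifs with hfloor
    · exact div_le_self hN (le_max_left _ _)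
    · exact div_max_le_of_floor_div_ne_zero hN hs (hu0 i hi) hfloor
  have hmem : ∀ i ∈ A, ⌊u i / s⌋₊ ∈ range (⌊1 / s⌋₊ + 1) := fun i hi => by
    rw [mem_range, Nat.lt_succ_iff]
    exact Nat.floor_le_floor (by gcongr; exact hu1 i hi)
  calc ∑ i ∈ A, N / max 1 (2 * N * u i) ≤ ∑ i ∈ A, F ⌊u i / s⌋₊ := sum_le_sum hle
    _ = ∑ r ∈ A.image fun i => ⌊u i / s⌋₊, F r :=
        (sum_image (injOn_floor_div_of_pairwise hs hu0 hsep)).symm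
    _ ≤ ∑ r ∈ range (⌊1 / s⌋₊ + 1), F r :=
        sum_le_sum_of_subset_of_nonneg (image_subset_iff.2 hmem) fun r _ _ => hF0 r
    _ = N + 1 / (2 * s) * (harmonic ⌊1 / s⌋₊ : ℝ) := by
        rw [sum_range_succ', add_comm, harmonic, Rat.cast_sum, mul_sum]
        simp [hF]
    _ ≤ N + 1 / (2 * s) * (1 + Real.log (1 / s)) := by
        gcongr
        exact harmonic_floor_le ((one_le_div hs).2 hs1)

theorem sum_linearMajorant_le_of_pairwise {ι : Type*} {A : Finset ι} {t : ι → UnitAddCircle}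
    {s : ℝ} (hs : 0 < s) (hs1 : s ≤ 1) (hsep : (A : Set ι).Pairwise fun i j => s ≤ ‖t i - t j‖)
    (N : ℕ) : ∑ i ∈ A, linearMajorant N (t i) ≤ 2 * N + 1 / s * (1 + Real.log (1 / s)) := by
  choose r hr hr_norm using fun i => exists_real_coe_eq_abs_eq_norm (t i)
  have hhalf : ∀ B ⊆ A, (∀ i ∈ B, ∀ j ∈ B, |(|r i| - |r j|)| = |r i - r j|) →
      ∑ i ∈ B, linearMajorant N (t i) ≤ N + 1 / (2 * s) * (1 + Real.log (1 / s)) := by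
    intro B hB hsign
    simp only [linearMajorant, ← hr_norm]
    refine sum_div_max_le_of_pairwise N.cast_nonneg hs hs1 (fun i _ => abs_nonneg _)
      (fun i _ => ?_) fun i hi j hj hij => ?_
    · rw [hr_norm]
      linarith [norm_le_half (t i)]
    · change s ≤ |(|r i| - |r j|)|
      rw [hsign i hi j hj]
      refine (hsep (hB hi) (hB hj) hij).trans ?_
      rw [← hr, ← hr, ← AddCircle.coe_sub]
      exact QuotientAddGroup.norm_mk_le_norm
  have hpos := hhalf {i ∈ A | 0 ≤ r i} (filter_subset _ _) fun i hi j hj => by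
    rw [abs_of_nonneg (mem_filter.1 hi).2, abs_of_nonneg (mem_filter.1 hj).2]
  have hneg := hhalf {i ∈ A | ¬0 ≤ r i} (filter_subset _ _) fun i hi j hj => by
    rw [abs_of_neg (not_le.1 (mem_filter.1 hi).2), abs_of_neg (not_le.1 (mem_filter.1 hj).2),
      neg_sub_neg, abs_sub_comm]
  have hdouble : 1 / s * (1 + Real.log (1 / s)) = 2 * (1 / (2 * s) * (1 + Real.log (1 / s))) := by
    field_simp
  rw [← sum_filter_add_sum_filter_not A fun i => 0 ≤ r i, hdouble]
  linarith

theorem sum_Ico_linearMajorant_nsmul_le {N : ℕ} {s : ℝ} (hs : 0 < s) (hs1 : s ≤ 1)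
    {c : UnitAddCircle} (hsep : ∀ h : ℕ, h ≠ 0 → h < N → s ≤ ‖h • c‖) (a : ℕ) :
    ∑ m ∈ Ico a (a + N), linearMajorant N (m • c) ≤ 2 * N + 1 / s * (1 + Real.log (1 / s)) := by
  have hlt : ∀ i ∈ Ico a (a + N), ∀ j ∈ Ico a (a + N), i < j → s ≤ ‖j • c - i • c‖ := by
    intro i hi j hj hij
    rw [mem_Ico] at hi hj
    rw [sub_eq_add_neg, ← sub_nsmul _ hij.le]
    exact hsep (j - i) (by omega) (by omega)
  refine sum_linearMajorant_le_of_pairwise hs hs1 (fun i hi j hj hij => ?_) N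
  rcases hij.lt_or_gt with h | h
  · rw [norm_sub_rev]
    exact hlt i hi j hj h
  · exact hlt j hj i hi h

theorem sum_Icc_linearMajorant_nsmul_le {N : ℕ} {s : ℝ} (hs : 0 < s) (hs1 : s ≤ 1)
    {c : UnitAddCircle} (hsep : ∀ h : ℕ, h ≠ 0 → h < N → s ≤ ‖h • c‖) (Q : ℕ) :
    ∑ m ∈ Icc 1 (Q * N), linearMajorant N (m • c)
      ≤ Q * (2 * N + 1 / s * (1 + Real.log (1 / s))) := by
  have hIcc : ∀ n, Icc 1 n = Ico 1 (1 + n) := fun n => by ext; simp; omega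
  rw [hIcc]
  induction Q with
  | zero => simp
  | succ Q ih =>
    have hblock := sum_Ico_linearMajorant_nsmul_le hs hs1 hsep (1 + Q * N)
    rw [add_mul, one_mul, ← add_assoc, ← sum_Ico_consecutive _ (Nat.le_add_right 1 (Q * N))
      (Nat.le_add_right _ N)]
    push_cast
    linarith

end SeparatedPoints

section Diophantine

/-- The Diophantine condition `‖kω‖ ≥ c / |k| ^ τ` for every nonzero integer `k`. Unlike the sets
`DC γ`, it has a power of `|k|` on the right, as the estimates of exponential sums need. -/
def IsDiophantine (c τ : ℝ) (ω : UnitAddCircle) : Prop :=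
  ∀ k : ℤ, k ≠ 0 → c / |(k : ℝ)| ^ τ ≤ ‖k • ω‖

variable {c ε : ℝ} {ω : UnitAddCircle}

theorem IsDiophantine.le_one {τ : ℝ} (hω : IsDiophantine c τ ω) : c ≤ 1 := by
  have hone := hω 1 one_ne_zero
  simp only [Int.cast_one, abs_one, Real.one_rpow, div_one, one_smul] at hone
  linarith [norm_le_half ω]

theorem exists_isDiophantine_of_mem_DC {γ : ℝ} (hγ : 0 < γ) (hε : 0 < ε) :
    ∃ c : ℝ, 0 < c ∧ ∀ ω ∈ DC γ, IsDiophantine c (1 + ε) ω := by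
  refine ⟨γ * ε ^ 2 / (4 * 2 ^ ε), by positivity, fun ω hω k hk => le_trans ?_ (hω k hk)⟩
  have hx : (1 : ℝ) ≤ |(k : ℝ)| := by exact_mod_cast Int.one_le_abs hk
  set x := |(k : ℝ)|
  have hlog_pos : 0 < Real.log (x + 1) := Real.log_pos (by linarith)
  have hlog : Real.log (x + 1) ≤ (2 * x) ^ (ε / 2) / (ε / 2) :=
    (Real.log_le_log (by linarith) (by linarith)).trans
      (Real.log_le_rpow_div (by linarith) (by positivity))
  have hlog_sq : Real.log (x + 1) ^ 2 ≤ 4 * 2 ^ ε / ε ^ 2 * x ^ ε := by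
    calc Real.log (x + 1) ^ 2 ≤ ((2 * x) ^ (ε / 2) / (ε / 2)) ^ 2 := by gcongr
      _ = ((2 * x) ^ (ε / 2)) ^ 2 * 4 / ε ^ 2 := by field_simp; ring
      _ = (2 * x) ^ ε * 4 / ε ^ 2 := by
          rw [← Real.rpow_natCast, ← Real.rpow_mul (by positivity)]
          norm_num
      _ = 4 * 2 ^ ε / ε ^ 2 * x ^ ε := by rw [Real.mul_rpow zero_le_two (by positivity)]; ring
  calc γ * ε ^ 2 / (4 * 2 ^ ε) / x ^ (1 + ε)
      = γ / (x * (4 * 2 ^ ε / ε ^ 2 * x ^ ε)) := by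
        rw [Real.rpow_add (by positivity), Real.rpow_one]; field_simp
    _ ≤ γ / (x * Real.log (x + 1) ^ 2) := by gcongr

theorem linearMajorant_mul_norm_le_one (N : ℕ) (a : UnitAddCircle) :
    linearMajorant N a * ‖a‖ ≤ 1 := by
  rw [linearMajorant, div_mul_eq_mul_div, div_le_one (by positivity)]
  refine le_trans ?_ (le_max_right _ _)
  nlinarith [mul_nonneg (Nat.cast_nonneg (α := ℝ) N) (norm_nonneg a)]

theorem IsDiophantine.linearMajorant_zsmul_le {τ : ℝ} (hω : IsDiophantine c τ ω) (hc : 0 < c)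
    {k : ℤ} (hk : k ≠ 0) (N : ℕ) : linearMajorant N (k • ω) ≤ |(k : ℝ)| ^ τ / c := by
  have hx : 0 < |(k : ℝ)| := by positivity
  have hmul : linearMajorant N (k • ω) * (c / |(k : ℝ)| ^ τ) ≤ 1 :=
    (mul_le_mul_of_nonneg_left (hω k hk) (linearMajorant_nonneg N _)).trans
      (linearMajorant_mul_norm_le_one N _)
  rw [le_div_iff₀ hc]
  rwa [← mul_div_assoc, div_le_one (by positivity)] at hmul

theorem IsDiophantine.sum_Icc_linearMajorant_le {τ : ℝ} (hω : IsDiophantine c τ ω) (hc : 0 < c)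
    (hτ : 0 ≤ τ) {k : ℤ} (hk : k ≠ 0) {N : ℕ} (hN : 1 ≤ N) (Q : ℕ) :
    ∑ m ∈ Icc 1 (Q * N), linearMajorant N (m • k • ω)
      ≤ Q * (2 * N + (N * |(k : ℝ)|) ^ τ / c * (1 + Real.log ((N * |(k : ℝ)|) ^ τ / c))) := by
  have hN' : (1 : ℝ) ≤ N := by exact_mod_cast hN
  have hx : (1 : ℝ) ≤ |(k : ℝ)| := by exact_mod_cast Int.one_le_abs hk
  have hNx : 1 ≤ N * |(k : ℝ)| := one_le_mul_of_one_le_of_one_le hN' hx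
  have hs : 0 < c / (N * |(k : ℝ)|) ^ τ := by positivity
  have hs1 : c / (N * |(k : ℝ)|) ^ τ ≤ 1 :=
    (div_le_one (by positivity)).2 (hω.le_one.trans (Real.one_le_rpow hNx hτ))
  have hsep : ∀ h : ℕ, h ≠ 0 → h < N → c / (N * |(k : ℝ)|) ^ τ ≤ ‖h • k • ω‖ := by
    intro h h_ne h_lt
    have h_pos : (0 : ℝ) < h := by positivity
    rw [← natCast_zsmul, smul_smul]
    refine le_trans ?_ (hω _ (mul_ne_zero (Int.natCast_ne_zero.2 h_ne) hk))
    push_cast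
    rw [abs_mul, Nat.abs_cast]
    gcongr
  simpa only [one_div_div] using sum_Icc_linearMajorant_nsmul_le hs hs1 hsep Q

theorem exists_div_mul_one_add_log_le (hc : 0 < c) (hε : 0 < ε) :
    ∃ A : ℝ, 0 < A ∧ ∀ X : ℝ, 1 ≤ X →
      X ^ (1 + ε) / c * (1 + Real.log (X ^ (1 + ε) / c)) ≤ A * X ^ (1 + 2 * ε) := by
  refine ⟨1 / c * (1 + |Real.log c| + (1 + ε) / ε), by positivity, fun X hX => ?_⟩
  have hXε : 1 ≤ X ^ ε := Real.one_le_rpow hX hε.le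
  have hlog : 1 + Real.log (X ^ (1 + ε) / c) ≤ (1 + |Real.log c| + (1 + ε) / ε) * X ^ ε := by
    calc 1 + Real.log (X ^ (1 + ε) / c)
        = 1 + -Real.log c + (1 + ε) * Real.log X := by
          rw [Real.log_div (by positivity) hc.ne', Real.log_rpow (by linarith)]; ring
      _ ≤ (1 + |Real.log c|) * X ^ ε + (1 + ε) * (X ^ ε / ε) := by
          gcongr
          · refine le_trans ?_ (le_mul_of_one_le_right (by positivity) hXε)
            gcongr
            exact neg_le_abs _
          · exact Real.log_le_rpow_div (by linarith) hε
      _ = (1 + |Real.log c| + (1 + ε) / ε) * X ^ ε := by ring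
  calc X ^ (1 + ε) / c * (1 + Real.log (X ^ (1 + ε) / c))
      ≤ X ^ (1 + ε) / c * ((1 + |Real.log c| + (1 + ε) / ε) * X ^ ε) := by gcongr
    _ = 1 / c * (1 + |Real.log c| + (1 + ε) / ε) * (X ^ (1 + ε) * X ^ ε) := by ring
    _ = 1 / c * (1 + |Real.log c| + (1 + ε) / ε) * X ^ (1 + 2 * ε) := by
        rw [← Real.rpow_add (by linarith)]; ring_nf

theorem IsDiophantine.linearMajorant_zsmul_le_mul_rpow (hω : IsDiophantine c (1 + ε) ω)
    (hc : 0 < c) (hε : 0 ≤ ε) {k : ℤ} (hk : k ≠ 0) {N : ℕ} (hkN : |(k : ℝ)| ≤ N) :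
    linearMajorant N (k • ω) ≤ 1 / c * (|(k : ℝ)| * (N : ℝ) ^ ε) := by
  have hx : 0 < |(k : ℝ)| := by positivity
  calc linearMajorant N (k • ω) ≤ |(k : ℝ)| ^ (1 + ε) / c := hω.linearMajorant_zsmul_le hc hk N
    _ = 1 / c * (|(k : ℝ)| * |(k : ℝ)| ^ ε) := by rw [Real.rpow_add hx, Real.rpow_one]; ring
    _ ≤ 1 / c * (|(k : ℝ)| * (N : ℝ) ^ ε) := by gcongr

theorem exists_sum_Icc_mul_linearMajorant_le (hc : 0 < c) (hε : 0 < ε) :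
    ∃ C : ℝ, 0 < C ∧ ∀ ω, IsDiophantine c (1 + ε) ω → ∀ k : ℤ, k ≠ 0 → ∀ N : ℕ, |(k : ℝ)| ≤ N →
      ∀ Q : ℕ, ∑ m ∈ Icc 1 (Q * N), linearMajorant N (m • k • ω)
        ≤ C * (Q * N * |(k : ℝ)| * (N : ℝ) ^ (4 * ε)) := by
  obtain ⟨A, hA, hlog⟩ := exists_div_mul_one_add_log_le hc hε
  refine ⟨2 + A, by positivity, fun ω hω k hk N hkN Q => ?_⟩
  have hx : (1 : ℝ) ≤ |(k : ℝ)| := by exact_mod_cast Int.one_le_abs hk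
  have hsum := hω.sum_Icc_linearMajorant_le hc (by positivity) hk
    (Nat.one_le_cast.1 (hx.trans hkN)) Q
  set x := |(k : ℝ)|
  have hN : (1 : ℝ) ≤ N := hx.trans hkN
  have hNx : 1 ≤ N * x := one_le_mul_of_one_le_of_one_le hN hx
  calc ∑ m ∈ Icc 1 (Q * N), linearMajorant N (m • k • ω)
      ≤ Q * (2 * N + (N * x) ^ (1 + ε) / c * (1 + Real.log ((N * x) ^ (1 + ε) / c))) := hsum
    _ ≤ Q * (2 * (N * x) ^ (1 + 2 * ε) + A * (N * x) ^ (1 + 2 * ε)) := by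
        refine mul_le_mul_of_nonneg_left (add_le_add ?_ (hlog _ hNx)) Q.cast_nonneg
        gcongr
        exact (le_mul_of_one_le_right (by positivity) hx).trans
          (Real.self_le_rpow_of_one_le hNx (by linarith))
    _ = (2 + A) * (Q * N * x * (N * x) ^ (2 * ε)) := by
        rw [Real.rpow_add (by positivity), Real.rpow_one]; ring
    _ ≤ (2 + A) * (Q * N * x * ((N : ℝ) ^ 2) ^ (2 * ε)) := by
        gcongr
        rw [sq]
        gcongr
    _ = (2 + A) * (Q * N * x * (N : ℝ) ^ (4 * ε)) := by
        rw [← Real.rpow_two, ← Real.rpow_mul (by positivity)]; ring_nf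

theorem exists_sum_Icc_pow_linearMajorant_le (hc : 0 < c) (hε : 0 < ε) :
    ∃ C : ℝ, 0 < C ∧ ∀ ω, IsDiophantine c (1 + ε) ω → ∀ k : ℤ, k ≠ 0 → ∀ N : ℕ, |(k : ℝ)| ≤ N →
      ∀ j : ℕ, ∑ m ∈ Icc 1 (N ^ j), linearMajorant N (m • k • ω)
        ≤ C * ((N : ℝ) ^ j * |(k : ℝ)| * (N : ℝ) ^ (4 * ε)) := by
  obtain ⟨C, hC, hsum⟩ := exists_sum_Icc_mul_linearMajorant_le hc hε
  refine ⟨1 / c + C, by positivity, fun ω hω k hk N hkN j => ?_⟩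
  have hN : (1 : ℝ) ≤ N := le_trans (by exact_mod_cast Int.one_le_abs hk) hkN
  cases j with
  | zero =>
    simp only [pow_zero, Icc_self, sum_singleton, one_smul, one_mul]
    refine (hω.linearMajorant_zsmul_le_mul_rpow hc hε.le hk hkN).trans ?_
    gcongr
    · exact le_add_of_nonneg_right hC.le
    · linarith
  | succ j =>
    have hblocks := hsum ω hω k hk N hkN (N ^ j)
    rw [← pow_succ, Nat.cast_pow, ← pow_succ] at hblocks
    refine hblocks.trans ?_
    gcongr
    exact le_add_of_nonneg_left (by positivity)

theorem exists_weylMajorant_zsmul_le (D : ℕ) (hc : 0 < c) (hε : 0 < ε) :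
    ∃ C : ℝ, 1 ≤ C ∧ ∀ ω, IsDiophantine c (1 + ε) ω → ∀ j ≤ D, ∀ k : ℤ, k ≠ 0 →
      ∀ N : ℕ, |(k : ℝ)| ≤ N → weylMajorant j N (k • ω)
        ≤ C * ((N : ℝ) ^ j * |(k : ℝ)| * (N : ℝ) ^ ((D ^ 2 + 4) * ε)) := by
  obtain ⟨C, hC, hsum⟩ := exists_sum_Icc_pow_linearMajorant_le hc hε
  obtain ⟨T, hT, hdiv⟩ := exists_card_divisors_le_mul_rpow hε
  refine ⟨1 + (D + T ^ D * C), le_add_of_nonneg_right (by positivity),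
    fun ω hω j hj k hk N hkN => ?_⟩
  have hx : (1 : ℝ) ≤ |(k : ℝ)| := by exact_mod_cast Int.one_le_abs hk
  have hsum_j := hsum ω hω k hk N hkN j
  set x := |(k : ℝ)|
  have hN : (1 : ℝ) ≤ N := hx.trans hkN
  set B := T * (N : ℝ) ^ (D * ε) with hB_def
  have hB : 1 ≤ B := one_le_mul_of_one_le_of_one_le hT (Real.one_le_rpow hN (by positivity))
  have hBdiv : ∀ l ∈ Icc 1 (N ^ D), (#l.divisors : ℝ) ≤ B := by
    intro l hl
    rw [mem_Icc] at hl
    refine (hdiv l (by omega)).trans ?_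
    have hlN : (l : ℝ) ≤ (N : ℝ) ^ D := by exact_mod_cast hl.2
    rw [hB_def, Real.rpow_mul (by positivity), Real.rpow_natCast]
    gcongr
  have hBD : B ^ D = T ^ D * (N : ℝ) ^ (D ^ 2 * ε) := by
    rw [hB_def, mul_pow, ← Real.rpow_natCast ((N : ℝ) ^ _), ← Real.rpow_mul (by positivity)]
    ring_nf
  set Y := (N : ℝ) ^ j * x * (N : ℝ) ^ ((D ^ 2 + 4) * ε) with hY_def
  have hNY : (N : ℝ) ^ j ≤ Y := by
    rw [hY_def, mul_assoc]
    exact le_mul_of_one_le_right (by positivity)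
      (one_le_mul_of_one_le_of_one_le hx (Real.one_le_rpow hN (by positivity)))
  calc weylMajorant j N (k • ω)
      ≤ j * (N : ℝ) ^ j + B ^ j * ∑ m ∈ Icc 1 (N ^ j), linearMajorant N (m • k • ω) :=
        weylMajorant_le_sum_linearMajorant (by positivity) hBdiv (by exact_mod_cast hN) hj _
    _ ≤ D * Y + B ^ D * (C * ((N : ℝ) ^ j * x * (N : ℝ) ^ (4 * ε))) := by
        gcongr
        exact sum_nonneg fun m _ => linearMajorant_nonneg _ _
    _ = (D + T ^ D * C) * Y := by
        rw [hBD, hY_def, add_mul (_ ^ 2 : ℝ), Real.rpow_add (by positivity)]; ring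
    _ ≤ (1 + (D + T ^ D * C)) * Y :=
        mul_le_mul_of_nonneg_right (le_add_of_nonneg_left zero_le_one) (by positivity)

theorem norm_sum_toCircle_div_le_one (f : ℕ → UnitAddCircle) (N : ℕ) :
    ‖∑ n ∈ range N, (toCircle (f n) : ℂ)‖ / N ≤ 1 := by
  refine div_le_one_of_le₀ ((norm_sum_le _ _).trans ?_) N.cast_nonneg
  simp [Circle.norm_coe]

theorem exists_norm_sum_toCircle_div_pow_le (D : ℕ) (hc : 0 < c) (hε : 0 < ε) :
    ∃ C : ℝ, 1 ≤ C ∧ ∀ ω, IsDiophantine c (1 + ε) ω → ∀ j ≤ D, ∀ k : ℤ, k ≠ 0 →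
      ∀ f : ℕ → UnitAddCircle, (Δ_[1])^[j + 1] f = (fun _ => k • ω) → ∀ N : ℕ, |(k : ℝ)| ≤ N →
        (‖∑ n ∈ range N, (toCircle (f n) : ℂ)‖ / N) ^ 2 ^ D
          ≤ C * (|(k : ℝ)| / N * (N : ℝ) ^ ((D ^ 2 + 4) * ε)) := by
  obtain ⟨C, hC, hW⟩ := exists_weylMajorant_zsmul_le D hc hε
  refine ⟨2 ^ 2 ^ D * C, one_le_mul_of_one_le_of_one_le (one_le_pow₀ one_le_two) hC,
    fun ω hω j hj k hk f hf N hkN => ?_⟩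
  have hWj := hW ω hω j hj k hk N hkN
  have hN : (0 : ℝ) < N := lt_of_lt_of_le (by positivity) hkN
  set L := (N : ℝ) ^ ((D ^ 2 + 4) * ε)
  refine (pow_le_pow_of_le_one (by positivity) (norm_sum_toCircle_div_le_one f N)
    (Nat.pow_le_pow_right two_pos hj)).trans ?_
  rw [div_pow, div_le_iff₀ (by positivity)]
  refine le_of_mul_le_mul_right ?_ (by positivity : (0 : ℝ) < N ^ (j + 1))
  calc ‖∑ n ∈ range N, (toCircle (f n) : ℂ)‖ ^ 2 ^ j * (N : ℝ) ^ (j + 1)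
      ≤ 2 ^ 2 ^ j * (N : ℝ) ^ 2 ^ j * weylMajorant j N (k • ω) :=
        norm_sum_toCircle_pow_le_weylMajorant j hf le_rfl
    _ ≤ 2 ^ 2 ^ D * (N : ℝ) ^ 2 ^ j * (C * ((N : ℝ) ^ j * |(k : ℝ)| * L)) := by
        gcongr
        exacts [weylMajorant_nonneg _ _ _, one_le_two, one_le_two]
    _ = 2 ^ 2 ^ D * C * (|(k : ℝ)| / N * L) * (N : ℝ) ^ 2 ^ j * (N : ℝ) ^ (j + 1) := by
        rw [pow_succ (N : ℝ) j]; field_simp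

theorem exists_norm_sum_toCircle_div_le (D : ℕ) (hc : 0 < c) (hε : 0 < ε) :
    ∃ C : ℝ, 1 ≤ C ∧ ∀ ω, IsDiophantine c (1 + ε) ω → ∀ j ≤ D, ∀ k : ℤ, k ≠ 0 →
      ∀ f : ℕ → UnitAddCircle, (Δ_[1])^[j + 1] f = (fun _ => k • ω) → ∀ N : ℕ, 1 ≤ N →
        ‖∑ n ∈ range N, (toCircle (f n) : ℂ)‖ / N
          ≤ C * ((|(k : ℝ)| / N) ^ ((2 : ℝ) ^ D)⁻¹ * (N : ℝ) ^ ((D ^ 2 + 4) * ε)) := by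
  obtain ⟨A, hA, hpow⟩ := exists_norm_sum_toCircle_div_pow_le D hc hε
  refine ⟨A, hA, fun ω hω j hj k hk f hf N hN => ?_⟩
  have hN' : (1 : ℝ) ≤ N := by exact_mod_cast hN
  have hδ0 : 0 < ((2 : ℝ) ^ D)⁻¹ := by positivity
  have hδ1 : ((2 : ℝ) ^ D)⁻¹ ≤ 1 := inv_le_one_of_one_le₀ (one_le_pow₀ one_le_two)
  have hL : 1 ≤ (N : ℝ) ^ ((D ^ 2 + 4) * ε) := Real.one_le_rpow hN' (by positivity)
  rcases le_or_gt |(k : ℝ)| N with hkN | hkN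
  · have hpow_N := hpow ω hω j hj k hk f hf N hkN
    rw [← Real.rpow_natCast, Nat.cast_pow, Nat.cast_ofNat,
      ← Real.le_rpow_inv_iff_of_pos (by positivity) (by positivity) (by positivity),
      Real.mul_rpow (x := A) (by positivity) (by positivity),
      Real.mul_rpow (x := |(k : ℝ)| / N) (by positivity) (by positivity)] at hpow_N
    refine hpow_N.trans ?_
    gcongr
    exacts [Real.rpow_le_self_of_one_le hA hδ1, Real.rpow_le_self_of_one_le hL hδ1]
  · have hratio : 1 ≤ |(k : ℝ)| / N := (one_le_div (by positivity)).2 hkN.le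
    exact (norm_sum_toCircle_div_le_one f N).trans (one_le_mul_of_one_le_of_one_le hA
      (one_le_mul_of_one_le_of_one_le (Real.one_le_rpow hratio hδ0.le) hL))

end Diophantine

section SkewProductOrbits

open UnitAddTorus

variable {d : ℕ}

theorem fwdDiff_iter_iterate_skewMap_apply (ω : UnitAddCircle) (x : Torus d) (m : ℕ) (i : Fin d)
    (hi : (i : ℕ) + m + 1 = d) :
    (Δ_[1])^[m + 1] (fun n => (skewMap d ω)^[n] x i) = fun _ => ω := by
  induction m generalizing i with
  | zero =>
    ext n
    change (skewMap d ω)^[n + 1] x i - (skewMap d ω)^[n] x i = ω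
    rw [Function.iterate_succ_apply', skewMap, dif_neg (by omega), add_sub_cancel_left]
  | succ m ih =>
    have hi' : (i : ℕ) + 1 < d := by omega
    have hdiff : Δ_[1] (fun n => (skewMap d ω)^[n] x i) =
        fun n => (skewMap d ω)^[n] x ⟨i + 1, hi'⟩ := by
      ext n
      simp only [fwdDiff, Function.iterate_succ_apply', skewMap]
      rw [dif_pos hi', add_sub_cancel_left]
    rw [Function.iterate_succ_apply, hdiff]
    exact ih ⟨i + 1, hi'⟩ (by simp only; omega)

theorem fwdDiff_iter_eq_zero_of_fwdDiff_iter_eq_const {G : Type*} [AddCommGroup G] {f : ℕ → G}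
    {c : G} {m n : ℕ} (hf : (Δ_[1])^[m] f = fun _ => c) (hmn : m < n) : (Δ_[1])^[n] f = 0 := by
  obtain ⟨r, rfl⟩ := Nat.exists_eq_add_of_lt hmn
  rw [add_assoc, add_comm, Function.iterate_add_apply, hf, Function.iterate_succ_apply,
    fwdDiff_const]
  exact Function.iterate_fixed (fwdDiff_const 1 0) r

theorem exists_fwdDiff_iter_character_eq_const (ω : UnitAddCircle) (x : Torus d) {k : Fin d → ℤ}
    (hk : k ≠ 0) : ∃ i : Fin d, k i ≠ 0 ∧ ∃ j ≤ d - 1,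
      (Δ_[1])^[j + 1] (fun n => ∑ l, k l • (skewMap d ω)^[n] x l) = fun _ => k i • ω := by
  obtain ⟨i, hki, hmin⟩ := WellFounded.has_min (wellFounded_lt (α := Fin d)) {i | k i ≠ 0}
    (Function.ne_iff.1 hk)
  refine ⟨i, hki, d - 1 - i, by omega, ?_⟩
  have hcoord : ∀ l, (Δ_[1])^[d - 1 - i + 1] (fun n => k l • (skewMap d ω)^[n] x l) =
      fun _ => if l = i then k i • ω else 0 := by
    intro l
    have horbit := fwdDiff_iter_iterate_skewMap_apply ω x (d - 1 - l) l (by omega)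
    refine (fwdDiff_iter_const_smul 1 (k l) (fun n => (skewMap d ω)^[n] x l) _).trans ?_
    rcases lt_trichotomy l i with hl | rfl | hl
    · rw [not_not.1 fun hkl => hmin l hkl hl, zero_smul, if_neg hl.ne]; rfl
    · rw [horbit, if_pos rfl]; rfl
    · rw [fwdDiff_iter_eq_zero_of_fwdDiff_iter_eq_const horbit (by omega), smul_zero,
        if_neg hl.ne']; rfl
  have hsum := fwdDiff_iter_finsetSum (M := ℕ) 1 univ
    (fun l n => k l • (skewMap d ω)^[n] x l) (d - 1 - i + 1)
  simp only [sum_fn] at hsum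
  rw [hsum]
  ext n
  simp only [hcoord, sum_ite_eq', mem_univ, if_true]

theorem mFourier_eq_toCircle_sum {ι : Type*} [Fintype ι] (k : ι → ℤ) (x : UnitAddTorus ι) :
    mFourier k x = (toCircle (∑ i, k i • x i) : ℂ) := by
  have hprod : ∀ s : Finset ι, ∏ i ∈ s, fourier (k i) (x i)
      = (toCircle (∑ i ∈ s, k i • x i) : ℂ) := by
    classical
    intro s
    induction s using Finset.induction_on with
    | empty => simp
    | insert a s ha ih =>
      rw [prod_insert ha, sum_insert ha, ih, AddCircle.toCircle_add, fourier_apply, Circle.coe_mul]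
  exact hprod univ

theorem exists_norm_sum_mFourier_iterate_skewMap_le (d : ℕ) {c ε : ℝ} (hc : 0 < c) (hε : 0 < ε) :
    ∃ C : ℝ, 1 ≤ C ∧ ∀ ω, IsDiophantine c (1 + ε) ω → ∀ k : Fin d → ℤ, k ≠ 0 → ∀ x : Torus d,
      ∀ N : ℕ, 1 ≤ N → ‖∑ n ∈ range N, mFourier k ((skewMap d ω)^[n] x)‖ / N
        ≤ C * ((‖k‖ / N) ^ ((2 : ℝ) ^ (d - 1))⁻¹ * (N : ℝ) ^ (((d - 1 : ℕ) ^ 2 + 4) * ε)) := by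
  obtain ⟨C, hC, hweyl⟩ := exists_norm_sum_toCircle_div_le (d - 1) hc hε
  refine ⟨C, hC, fun ω hω k hk x N hN => ?_⟩
  obtain ⟨i, hki, j, hj, hphase⟩ := exists_fwdDiff_iter_character_eq_const ω x hk
  have hki_le : |(k i : ℝ)| ≤ ‖k‖ := (Int.norm_eq_abs (k i)).symm.trans_le (norm_le_pi_norm k i)
  simp only [mFourier_eq_toCircle_sum]
  refine (hweyl ω hω j hj (k i) hki _ hphase N hN).trans ?_
  gcongr

end SkewProductOrbits

section Fourier

open MeasureTheory UnitAddTorus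

instance : IsProbabilityMeasure (volume : Measure UnitAddCircle) := ⟨UnitAddCircle.measure_univ⟩

theorem integrable_of_continuous {X E : Type*} [TopologicalSpace X] [CompactSpace X]
    [MeasurableSpace X] [OpensMeasurableSpace X] [NormedAddCommGroup E] {μ : Measure X}
    [IsFiniteMeasureOnCompacts μ] {f : X → E} (hf : Continuous f) : Integrable f μ :=
  hf.integrable_of_hasCompactSupport (HasCompactSupport.of_compactSpace f)

theorem integral_fourier_eq_ite (n : ℤ) :
    ∫ y : UnitAddCircle, fourier n y = if n = 0 then 1 else 0 := by
  split_ifs with hn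
  · simp [hn]
  · have hshift := integral_add_right_eq_self (μ := (volume : Measure UnitAddCircle))
      (fun y => fourier n y) (((1 : ℝ) / 2 / n : ℝ) : UnitAddCircle)
    simp only [fourier_add_half_inv_index hn one_pos] at hshift
    rw [integral_neg] at hshift
    exact self_eq_neg.1 hshift.symm

theorem integral_sum_fourier_mul_fourier_neg {S : Finset ℤ} (c : ℤ → ℂ) {k : ℤ} (hk : k ∈ S) :
    ∫ y : UnitAddCircle, (∑ l ∈ S, c l * fourier l y) * fourier (-k) y = c k := by
  simp only [sum_mul, mul_assoc, ← fourier_add]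
  rw [integral_finsetSum _ fun l _ => integrable_of_continuous (by fun_prop)]
  simp only [integral_const_mul, integral_fourier_eq_ite, ← sub_eq_add_neg, sub_eq_zero, mul_ite,
    mul_one, mul_zero, sum_ite_eq', hk, if_true]

/-- The trigonometric polynomial with coefficients `a 0, …, a (L - 1)`. -/
noncomputable def trigPoly (a : ℕ → ℝ) (L : ℕ) (y : UnitAddCircle) : ℂ :=
  ∑ n ∈ range L, (a n : ℂ) * fourier (n : ℤ) y

theorem continuous_trigPoly (a : ℕ → ℝ) (L : ℕ) : Continuous (trigPoly a L) := by
  unfold trigPoly; fun_prop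

theorem norm_sq_trigPoly (a : ℕ → ℝ) (L : ℕ) (y : UnitAddCircle) :
    ((‖trigPoly a L y‖ ^ 2 : ℝ) : ℂ)
      = ∑ p ∈ range L ×ˢ range L, ((a p.1 * a p.2 : ℝ) : ℂ) * fourier ((p.1 : ℤ) - p.2) y := by
  rw [← Complex.normSq_eq_norm_sq, ← Complex.mul_conj, trigPoly, map_sum, sum_mul_sum,
    sum_product]
  refine sum_congr rfl fun n _ => sum_congr rfl fun m _ => ?_
  rw [map_mul, Complex.conj_ofReal, ← fourier_neg, sub_eq_add_neg, fourier_add]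
  push_cast
  ring

theorem norm_sq_trigPoly_eq_sum_Icc (a : ℕ → ℝ) (L : ℕ) (y : UnitAddCircle) :
    ((‖trigPoly a L y‖ ^ 2 : ℝ) : ℂ)
      = ∑ k ∈ Icc (-(L : ℤ)) L, (∑ p ∈ range L ×ˢ range L with (p.1 : ℤ) - p.2 = k,
          ((a p.1 * a p.2 : ℝ) : ℂ)) * fourier k y := by
  have hmem : ∀ p ∈ range L ×ˢ range L, (p.1 : ℤ) - p.2 ∈ Icc (-(L : ℤ)) L := fun p hp => by
    simp only [mem_product, mem_range] at hp
    rw [mem_Icc]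
    omega
  rw [norm_sq_trigPoly, ← sum_fiberwise_of_maps_to hmem]
  refine sum_congr rfl fun k _ => ?_
  rw [sum_mul]
  refine sum_congr rfl fun p hp => ?_
  rw [(mem_filter.1 hp).2]

theorem integral_norm_sq_trigPoly (a : ℕ → ℝ) (L : ℕ) :
    ∫ y, ‖trigPoly a L y‖ ^ 2 = ∑ n ∈ range L, a n ^ 2 := by
  have hcomplex : ∫ y, ((‖trigPoly a L y‖ ^ 2 : ℝ) : ℂ) = ((∑ n ∈ range L, a n ^ 2 : ℝ) : ℂ) := by
    simp only [norm_sq_trigPoly]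
    rw [integral_finsetSum _ fun p _ => integrable_of_continuous (by fun_prop), sum_product]
    push_cast
    refine sum_congr rfl fun n hn => ?_
    simp only [integral_const_mul, integral_fourier_eq_ite, sub_eq_zero, Nat.cast_inj, mul_ite,
      mul_one, mul_zero, sum_ite_eq, hn, if_true, sq]
  rw [integral_complex_ofReal] at hcomplex
  exact_mod_cast hcomplex

theorem fourier_one_sub_one_mul_trigPoly {a : ℕ → ℝ} {L : ℕ} (h0 : a 0 = 0) (hL : a L = 0)
    (y : UnitAddCircle) :
    (fourier 1 y - 1) * trigPoly a L y = trigPoly (fun n => a (n - 1) - a n) (L + 1) y := by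
  have hshift : fourier 1 y * trigPoly a L y
      = ∑ n ∈ range (L + 1), (a (n - 1) : ℂ) * fourier (n : ℤ) y := by
    rw [sum_range_succ', trigPoly, mul_sum]
    simp only [Nat.add_sub_cancel, h0, Nat.zero_sub, Complex.ofReal_zero, zero_mul, add_zero]
    refine sum_congr rfl fun n _ => ?_
    push_cast
    rw [fourier_add]; ring
  have hextend : trigPoly a L y = ∑ n ∈ range (L + 1), (a n : ℂ) * fourier (n : ℤ) y := by
    rw [sum_range_succ, hL, trigPoly, Complex.ofReal_zero, zero_mul, add_zero]
  rw [sub_mul, hshift, one_mul, hextend, ← sum_sub_distrib, trigPoly]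
  refine sum_congr rfl fun n _ => ?_
  push_cast; ring

theorem integral_norm_sq_trigPoly_mul_norm_sq_le {a : ℕ → ℝ} {L : ℕ} (h0 : a 0 = 0)
    (hL : a L = 0) :
    ∫ y, ‖trigPoly a L y‖ ^ 2 * ‖y‖ ^ 2
      ≤ (∑ n ∈ range (L + 1), (a (n - 1) - a n) ^ 2) / 16 := by
  rw [← integral_norm_sq_trigPoly, ← integral_div]
  have hcont := continuous_trigPoly a L
  have hcont_diff := continuous_trigPoly (fun n => a (n - 1) - a n) (L + 1)
  refine integral_mono (integrable_of_continuous (by fun_prop))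
    (integrable_of_continuous (by fun_prop)) fun y => ?_
  have hnorm : (4 * ‖y‖) ^ 2 ≤ ‖(toCircle y : ℂ) - 1‖ ^ 2 := by
    gcongr
    exact four_mul_norm_le_norm_toCircle_sub_one y
  beta_reduce
  rw [← fourier_one_sub_one_mul_trigPoly h0 hL, norm_mul, mul_pow, fourier_one]
  nlinarith [sq_nonneg ‖trigPoly a L y‖]

end Fourier

section JacksonKernel

open MeasureTheory UnitAddTorus

/-- The coefficients of the trigonometric polynomial whose squared modulus is the Jackson kernel:
the tent function on `0, …, 2 M` with peak at `M`. -/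
def tentCoeff (M n : ℕ) : ℝ := min (n : ℝ) (2 * M - n)

theorem tentCoeff_zero (M : ℕ) : tentCoeff M 0 = 0 := by simp [tentCoeff]

theorem tentCoeff_two_mul (M : ℕ) : tentCoeff M (2 * M) = 0 := by simp [tentCoeff]

theorem tentCoeff_pred_sub_sq_le_one (M n : ℕ) :
    (tentCoeff M (n - 1) - tentCoeff M n) ^ 2 ≤ 1 := by
  rw [sq_le_one_iff_abs_le_one]
  cases n with
  | zero => simp
  | succ n =>
    simp only [tentCoeff, Nat.add_sub_cancel]
    refine (abs_min_sub_min_le_max _ _ _ _).trans (max_le ?_ ?_) <;>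
      push_cast <;> rw [abs_le] <;> constructor <;> linarith

theorem cube_le_three_mul_sum_sq (M : ℕ) :
    (M : ℝ) ^ 3 ≤ 3 * ∑ n ∈ range (M + 1), (n : ℝ) ^ 2 := by
  induction M with
  | zero => simp
  | succ M ih =>
    rw [sum_range_succ]
    push_cast
    nlinarith [Nat.cast_nonneg (α := ℝ) M]

theorem cube_le_three_mul_sum_tentCoeff_sq (M : ℕ) :
    (M : ℝ) ^ 3 ≤ 3 * ∑ n ∈ range (2 * M), tentCoeff M n ^ 2 := by
  refine (cube_le_three_mul_sum_sq M).trans ?_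
  gcongr
  calc ∑ n ∈ range (M + 1), (n : ℝ) ^ 2 = ∑ n ∈ range (M + 1), tentCoeff M n ^ 2 := by
        refine sum_congr rfl fun n hn => ?_
        have hn : (n : ℝ) ≤ M := by exact_mod_cast Nat.lt_succ_iff.1 (mem_range.1 hn)
        rw [tentCoeff, min_eq_left (by linarith)]
    _ ≤ ∑ n ∈ range (2 * M + 1), tentCoeff M n ^ 2 :=
        sum_le_sum_of_subset_of_nonneg (range_mono (by omega)) fun _ _ _ => sq_nonneg _
    _ = ∑ n ∈ range (2 * M), tentCoeff M n ^ 2 := by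
        rw [sum_range_succ, tentCoeff_two_mul, sq, mul_zero, add_zero]

theorem sum_tentCoeff_sq_pos {M : ℕ} (hM : 1 ≤ M) :
    0 < ∑ n ∈ range (2 * M), tentCoeff M n ^ 2 := by
  have hM3 : (0 : ℝ) < (M : ℝ) ^ 3 := by positivity
  linarith [cube_le_three_mul_sum_tentCoeff_sq M]

/-- The Jackson kernel of degree at most `2 M`: up to a shift in frequency, the square of a Fejér
kernel, normalized to have integral one. -/
noncomputable def jacksonKernel (M : ℕ) (y : UnitAddCircle) : ℝ :=
  ‖trigPoly (tentCoeff M) (2 * M) y‖ ^ 2 / ∑ n ∈ range (2 * M), tentCoeff M n ^ 2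

/-- The Fourier coefficients of the Jackson kernel. -/
noncomputable def jacksonCoeff (M : ℕ) (k : ℤ) : ℂ :=
  ∫ y, (jacksonKernel M y : ℂ) * fourier (-k) y

variable {M : ℕ}

@[fun_prop]
theorem continuous_jacksonKernel (M : ℕ) : Continuous (jacksonKernel M) :=
  ((continuous_trigPoly _ _).norm.pow 2).div_const _

theorem jacksonKernel_nonneg (M : ℕ) (y : UnitAddCircle) : 0 ≤ jacksonKernel M y :=
  div_nonneg (sq_nonneg _) (sum_nonneg fun _ _ => sq_nonneg _)

theorem integral_jacksonKernel (hM : 1 ≤ M) : ∫ y, jacksonKernel M y = 1 := by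
  simp only [jacksonKernel]
  rw [integral_div, integral_norm_sq_trigPoly, div_self (sum_tentCoeff_sq_pos hM).ne']

theorem integral_jacksonKernel_mul_norm_sq_le (hM : 1 ≤ M) :
    ∫ y, jacksonKernel M y * ‖y‖ ^ 2 ≤ 1 / (M : ℝ) ^ 2 := by
  have hM' : (1 : ℝ) ≤ M := by exact_mod_cast hM
  have hdiff : ∑ n ∈ range (2 * M + 1), (tentCoeff M (n - 1) - tentCoeff M n) ^ 2 ≤ 3 * M := by
    calc ∑ n ∈ range (2 * M + 1), (tentCoeff M (n - 1) - tentCoeff M n) ^ 2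
        ≤ ∑ _n ∈ range (2 * M + 1), (1 : ℝ) :=
          sum_le_sum fun n _ => tentCoeff_pred_sub_sq_le_one M n
      _ ≤ 3 * M := by
          rw [sum_const, card_range, nsmul_one]
          push_cast
          linarith
  have hmoment : ∫ y, ‖trigPoly (tentCoeff M) (2 * M) y‖ ^ 2 * ‖y‖ ^ 2 ≤ 3 * M / 16 := by
    linarith [integral_norm_sq_trigPoly_mul_norm_sq_le (tentCoeff_zero M) (tentCoeff_two_mul M)]
  simp only [jacksonKernel, div_mul_eq_mul_div]
  rw [integral_div, div_le_div_iff₀ (sum_tentCoeff_sq_pos hM) (by positivity), one_mul]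
  calc _ ≤ 3 * M / 16 * (M : ℝ) ^ 2 := by gcongr
    _ ≤ ∑ n ∈ range (2 * M), tentCoeff M n ^ 2 := by
        nlinarith [cube_le_three_mul_sum_tentCoeff_sq M, pow_pos (zero_lt_one.trans_le hM') 3]

theorem jacksonCoeff_zero (hM : 1 ≤ M) : jacksonCoeff M 0 = 1 := by
  simp only [jacksonCoeff, neg_zero, fourier_zero, mul_one]
  rw [integral_complex_ofReal, integral_jacksonKernel hM, Complex.ofReal_one]

theorem norm_jacksonCoeff_le_one (hM : 1 ≤ M) (k : ℤ) : ‖jacksonCoeff M k‖ ≤ 1 := by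
  refine ((norm_integral_le_integral_norm _).trans_eq ?_).trans_eq (integral_jacksonKernel hM)
  congr with y
  rw [norm_mul, Complex.norm_of_nonneg (jacksonKernel_nonneg M y), fourier_apply,
    Circle.norm_coe, mul_one]

theorem jacksonKernel_eq_sum (M : ℕ) (y : UnitAddCircle) :
    (jacksonKernel M y : ℂ)
      = ∑ k ∈ Icc (-((2 * M : ℕ) : ℤ)) (2 * M : ℕ), jacksonCoeff M k * fourier k y := by
  obtain ⟨c, hc⟩ : ∃ c : ℤ → ℂ, ∀ y, (jacksonKernel M y : ℂ)
      = ∑ k ∈ Icc (-((2 * M : ℕ) : ℤ)) (2 * M : ℕ), c k * fourier k y := by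
    refine ⟨fun k => (∑ p ∈ range (2 * M) ×ˢ range (2 * M) with (p.1 : ℤ) - p.2 = k,
      ((tentCoeff M p.1 * tentCoeff M p.2 : ℝ) : ℂ)) / (∑ n ∈ range (2 * M), tentCoeff M n ^ 2 : ℝ),
      fun y => ?_⟩
    rw [jacksonKernel, Complex.ofReal_div, norm_sq_trigPoly_eq_sum_Icc, sum_div]
    exact sum_congr rfl fun k _ => mul_div_right_comm _ _ _
  rw [hc]
  refine sum_congr rfl fun k hk => ?_
  rw [jacksonCoeff, ← integral_sum_fourier_mul_fourier_neg c hk]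
  simp only [hc]

end JacksonKernel

section TorusFourier

open MeasureTheory UnitAddTorus

variable {ι : Type*} [Fintype ι]

theorem norm_mFourier_apply (k : ι → ℤ) (x : UnitAddTorus ι) : ‖mFourier k x‖ = 1 := by
  rw [mFourier_eq_toCircle_sum, Circle.norm_coe]

theorem mFourier_apply_add (k : ι → ℤ) (x y : UnitAddTorus ι) :
    mFourier k (x + y) = mFourier k x * mFourier k y := by
  simp only [mFourier_eq_toCircle_sum, Pi.add_apply, smul_add, sum_add_distrib,
    AddCircle.toCircle_add, Circle.coe_mul]

theorem mFourier_apply_neg (k : ι → ℤ) (x : UnitAddTorus ι) :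
    mFourier k (-x) = mFourier (-k) x := by
  simp only [mFourier_eq_toCircle_sum, Pi.neg_apply, smul_neg, neg_smul]

theorem exists_norm_apply_eq_norm [Nonempty ι] {E : Type*} [SeminormedAddGroup E] (f : ι → E) :
    ∃ i, ‖f i‖ = ‖f‖ := by
  obtain ⟨i, hi⟩ := Finite.exists_max fun i => ‖f i‖
  exact ⟨i, (norm_le_pi_norm f i).antisymm ((pi_norm_le_iff_of_nonempty _).2 hi)⟩

theorem one_le_norm_of_ne_zero {k : ι → ℤ} (hk : k ≠ 0) : 1 ≤ ‖k‖ := by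
  obtain ⟨i, hi⟩ := Function.ne_iff.1 hk
  refine le_trans ?_ (norm_le_pi_norm k i)
  rw [Int.norm_eq_abs]
  exact_mod_cast Int.one_le_abs hi

theorem exists_mFourier_eq_neg_one {k : ι → ℤ} (hk : k ≠ 0) :
    ∃ v : UnitAddTorus ι, mFourier k v = -1 ∧ ‖v‖ ≤ ‖k‖⁻¹ := by
  classical
  have : Nonempty ι := (Function.ne_iff.1 hk).nonempty
  obtain ⟨i, hi⟩ := exists_norm_apply_eq_norm k
  have hki : k i ≠ 0 := fun h => by
    have := one_le_norm_of_ne_zero hk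
    rw [← hi, h, norm_zero] at this
    linarith
  refine ⟨Pi.single i ((1 / 2 / k i : ℝ) : UnitAddCircle), ?_, ?_⟩
  · have hhalf := fourier_add_half_inv_index hki one_pos 0
    rw [zero_add, fourier_eval_zero, fourier_apply] at hhalf
    rw [mFourier_eq_toCircle_sum, sum_eq_single i (fun j _ hj => by
      rw [Pi.single_eq_of_ne hj, smul_zero]) (by simp), Pi.single_eq_same]
    exact hhalf
  · rw [Pi.norm_single, ← hi, Int.norm_eq_abs]
    refine QuotientAddGroup.norm_mk_le_norm.trans ?_
    rw [Real.norm_eq_abs, abs_div, ← one_div]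
    gcongr
    norm_num [abs_of_pos]

/-- Translating by half a period of the character turns twice the Fourier coefficient into the
integral of an increment of `φ`. -/
theorem norm_integral_mul_mFourier_neg_le {α H : NNReal} {φ : C(UnitAddTorus ι, ℝ)}
    (hφ : HolderWith H α φ) {k : ι → ℤ} (hk : k ≠ 0) :
    ‖∫ y, (φ y : ℂ) * mFourier (-k) y‖ ≤ H * ‖k‖ ^ (-(α : ℝ)) := by
  obtain ⟨v, hv, hvk⟩ := exists_mFourier_eq_neg_one (neg_ne_zero.2 hk)
  rw [norm_neg] at hvk
  have hint (z : UnitAddTorus ι) :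
      Integrable (fun y => (φ (y + z) : ℂ) * mFourier (-k) y) volume :=
    integrable_of_continuous (by fun_prop)
  have hshift : ∫ y, (φ y : ℂ) * mFourier (-k) y = -∫ y, (φ (y + v) : ℂ) * mFourier (-k) y := by
    rw [← integral_add_right_eq_self (fun y => (φ y : ℂ) * mFourier (-k) y) v, ← integral_neg]
    simp only [mFourier_apply_add, hv, mul_neg, mul_one]
  have htwo : 2 * ∫ y, (φ y : ℂ) * mFourier (-k) y
      = ∫ y, ((φ y : ℂ) - φ (y + v)) * mFourier (-k) y := by
    simp only [sub_mul]
    rw [integral_sub (by simpa using hint 0) (hint v), two_mul, sub_eq_add_neg, ← hshift]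
  have hbound : ‖∫ y, ((φ y : ℂ) - φ (y + v)) * mFourier (-k) y‖ ≤ H * ‖k‖ ^ (-(α : ℝ)) := by
    refine (norm_integral_le_of_norm_le_const (C := H * ‖k‖ ^ (-(α : ℝ)))
      (Eventually.of_forall fun y => ?_)).trans (by simp)
    rw [norm_mul, norm_mFourier_apply, mul_one, ← Complex.ofReal_sub, Complex.norm_real,
      ← dist_eq_norm]
    refine (hφ.dist_le _ _).trans ?_
    rw [dist_self_add_right, Real.rpow_neg (norm_nonneg _), ← Real.inv_rpow (norm_nonneg _)]
    gcongr
  rw [← htwo, norm_mul, Complex.norm_two] at hbound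
  linarith [norm_nonneg (∫ y, (φ y : ℂ) * mFourier (-k) y)]

end TorusFourier

section Approximation

open MeasureTheory UnitAddTorus

variable {ι : Type*} [Fintype ι]

theorem rpow_le_rpow_neg_mul_one_add_sq {M r α : ℝ} (hM : 0 < M) (hr : 0 ≤ r) (hα0 : 0 ≤ α)
    (hα : α ≤ 1) : r ^ α ≤ M ^ (-α) * (1 + M ^ 2 * r ^ 2) := by
  rw [Real.rpow_neg hM.le, ← div_eq_inv_mul, le_div_iff₀ (by positivity), mul_comm,
    ← Real.mul_rpow hM.le hr, ← mul_pow]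
  have hMr : 0 ≤ M * r := by positivity
  rcases le_total (M * r) 1 with h | h
  · exact (Real.rpow_le_one hMr h hα0).trans (by linarith [sq_nonneg (M * r)])
  · exact (Real.rpow_le_self_of_one_le h hα).trans (by nlinarith)

theorem sq_norm_le_sum_sq_norm {E : Type*} [SeminormedAddGroup E] (y : ι → E) :
    ‖y‖ ^ 2 ≤ ∑ i, ‖y i‖ ^ 2 := by
  have hsum : 0 ≤ ∑ i, ‖y i‖ ^ 2 := sum_nonneg fun i _ => sq_nonneg _
  rw [← Real.le_sqrt (norm_nonneg _) hsum, pi_norm_le_iff_of_nonneg (Real.sqrt_nonneg _)]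
  exact fun i => Real.le_sqrt_of_sq_le
    (single_le_sum (f := fun i => ‖y i‖ ^ 2) (fun _ _ => sq_nonneg _) (mem_univ i))

theorem integral_mul_norm_rpow_le {K : UnitAddTorus ι → ℝ} (hKc : Continuous K)
    (hK0 : ∀ y, 0 ≤ K y) (hK1 : ∫ y, K y = 1) {M : ℝ} (hM : 0 < M)
    (hK2 : ∀ i, ∫ y, K y * ‖y i‖ ^ 2 ≤ 1 / M ^ 2) {α : ℝ} (hα0 : 0 ≤ α) (hα : α ≤ 1) :
    ∫ y, K y * ‖y‖ ^ α ≤ (1 + Fintype.card ι) * M ^ (-α) := by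
  have hbound (y : UnitAddTorus ι) :
      K y * ‖y‖ ^ α ≤ M ^ (-α) * (K y + M ^ 2 * ∑ i, K y * ‖y i‖ ^ 2) := by
    rw [← mul_sum]
    calc K y * ‖y‖ ^ α ≤ K y * (M ^ (-α) * (1 + M ^ 2 * ‖y‖ ^ 2)) :=
          mul_le_mul_of_nonneg_left
            (rpow_le_rpow_neg_mul_one_add_sq hM (norm_nonneg y) hα0 hα) (hK0 y)
      _ ≤ K y * (M ^ (-α) * (1 + M ^ 2 * ∑ i, ‖y i‖ ^ 2)) := by
          have := hK0 y
          gcongr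
          exact sq_norm_le_sum_sq_norm y
      _ = M ^ (-α) * (K y + M ^ 2 * (K y * ∑ i, ‖y i‖ ^ 2)) := by ring
  have hmoment (i : ι) : Integrable (fun y : UnitAddTorus ι => K y * ‖y i‖ ^ 2) volume :=
    integrable_of_continuous (by fun_prop)
  calc ∫ y, K y * ‖y‖ ^ α ≤ ∫ y, M ^ (-α) * (K y + M ^ 2 * ∑ i, K y * ‖y i‖ ^ 2) :=
        integral_mono (integrable_of_continuous
          (hKc.mul (continuous_norm.rpow_const fun _ => Or.inr hα0)))
          (integrable_of_continuous (by fun_prop)) hbound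
    _ = M ^ (-α) * (1 + M ^ 2 * ∑ i, ∫ y, K y * ‖y i‖ ^ 2) := by
        rw [integral_const_mul, integral_add (integrable_of_continuous hKc)
          ((integrable_finsetSum _ fun i _ => hmoment i).const_mul _), hK1, integral_const_mul,
          integral_finsetSum _ fun i _ => hmoment i]
    _ ≤ M ^ (-α) * (1 + M ^ 2 * ∑ _i : ι, 1 / M ^ 2) := by
        gcongr with i
        exact hK2 i
    _ = (1 + Fintype.card ι) * M ^ (-α) := by
        rw [sum_const, card_univ, nsmul_eq_mul]
        field_simp

theorem abs_sub_integral_sub_mul_le {α H : NNReal} {φ : C(UnitAddTorus ι, ℝ)}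
    (hφ : HolderWith H α φ) {K : UnitAddTorus ι → ℝ} (hKc : Continuous K) (hK0 : ∀ y, 0 ≤ K y)
    (hK1 : ∫ y, K y = 1) (x : UnitAddTorus ι) :
    |φ x - ∫ y, φ (x - y) * K y| ≤ H * ∫ y, K y * ‖y‖ ^ (α : ℝ) := by
  have hsub : φ x - ∫ y, φ (x - y) * K y = ∫ y, (φ x - φ (x - y)) * K y := by
    simp only [sub_mul]
    rw [integral_sub (integrable_of_continuous (by fun_prop))
      (integrable_of_continuous (by fun_prop)), integral_const_mul, hK1, mul_one]
  rw [hsub, ← integral_const_mul]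
  refine abs_integral_le_integral_abs.trans (integral_mono
    (integrable_of_continuous (by fun_prop)) (integrable_of_continuous
      ((hKc.mul (continuous_norm.rpow_const fun _ => Or.inr α.coe_nonneg)).const_mul _))
    fun y => ?_)
  have hdist := hφ.dist_le x (x - y)
  rw [dist_self_sub_right, Real.dist_eq] at hdist
  simp only [abs_mul, abs_of_nonneg (hK0 y)]
  rw [mul_left_comm, mul_comm]
  exact mul_le_mul_of_nonneg_left hdist (hK0 y)

/-- The frequencies all of whose coordinates are at most `R` in absolute value. -/
noncomputable def frequencyBox (ι : Type*) [Fintype ι] [DecidableEq ι] (R : ℕ) : Finset (ι → ℤ) :=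
  Fintype.piFinset fun _ => Icc (-(R : ℤ)) R

theorem mem_frequencyBox [DecidableEq ι] {R : ℕ} {k : ι → ℤ} :
    k ∈ frequencyBox ι R ↔ ‖k‖ ≤ R := by
  simp only [frequencyBox, Fintype.mem_piFinset, mem_Icc, ← abs_le,
    pi_norm_le_iff_of_nonneg (Nat.cast_nonneg R), Int.norm_eq_abs]
  norm_cast

/-- The product of the one-dimensional Jackson kernels: an approximate identity on the torus. -/
noncomputable def torusJacksonKernel (M : ℕ) (y : UnitAddTorus ι) : ℝ :=
  ∏ i, jacksonKernel M (y i)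

@[fun_prop]
theorem continuous_torusJacksonKernel (M : ℕ) :
    Continuous (torusJacksonKernel M : UnitAddTorus ι → ℝ) := by
  unfold torusJacksonKernel; fun_prop

theorem torusJacksonKernel_nonneg (M : ℕ) (y : UnitAddTorus ι) : 0 ≤ torusJacksonKernel M y :=
  prod_nonneg fun _ _ => jacksonKernel_nonneg M _

variable {M : ℕ}

theorem integral_torusJacksonKernel (hM : 1 ≤ M) :
    ∫ y : UnitAddTorus ι, torusJacksonKernel M y = 1 := by
  simp only [torusJacksonKernel]
  rw [integral_fintype_prod_volume_eq_prod fun _ => jacksonKernel M]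
  simp only [integral_jacksonKernel hM, prod_const_one]

theorem integral_torusJacksonKernel_mul_norm_sq_le (hM : 1 ≤ M) (i : ι) :
    ∫ y : UnitAddTorus ι, torusJacksonKernel M y * ‖y i‖ ^ 2 ≤ 1 / (M : ℝ) ^ 2 := by
  classical
  have hfactor (y : UnitAddTorus ι) : torusJacksonKernel M y * ‖y i‖ ^ 2
      = ∏ j, jacksonKernel M (y j) * if j = i then ‖y j‖ ^ 2 else 1 := by
    rw [prod_mul_distrib, prod_ite_eq' univ i, if_pos (mem_univ i), torusJacksonKernel]
  simp only [hfactor]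
  rw [integral_fintype_prod_volume_eq_prod
    fun j u => jacksonKernel M u * if j = i then ‖u‖ ^ 2 else 1, Fintype.prod_eq_single i]
  · simpa using integral_jacksonKernel_mul_norm_sq_le hM
  · intro j hj
    simp only [if_neg hj, mul_one, integral_jacksonKernel hM]

theorem torusJacksonKernel_eq_sum [DecidableEq ι] (M : ℕ) (y : UnitAddTorus ι) :
    (torusJacksonKernel M y : ℂ)
      = ∑ k ∈ frequencyBox ι (2 * M), (∏ i, jacksonCoeff M (k i)) * mFourier k y := by
  simp only [torusJacksonKernel, Complex.ofReal_prod, jacksonKernel_eq_sum]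
  rw [prod_univ_sum]
  exact sum_congr rfl fun k _ => prod_mul_distrib

theorem integral_sub_mul_torusJacksonKernel [DecidableEq ι] (M : ℕ) (φ : C(UnitAddTorus ι, ℝ))
    (x : UnitAddTorus ι) :
    ((∫ y, φ (x - y) * torusJacksonKernel M y : ℝ) : ℂ) = ∑ k ∈ frequencyBox ι (2 * M),
      (∏ i, jacksonCoeff M (k i)) * (∫ y, (φ y : ℂ) * mFourier (-k) y) * mFourier k x := by
  have hexpand (y : UnitAddTorus ι) : ((φ y * torusJacksonKernel M (x - y) : ℝ) : ℂ) =
      ∑ k ∈ frequencyBox ι (2 * M), (∏ i, jacksonCoeff M (k i)) * mFourier k x *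
        ((φ y : ℂ) * mFourier (-k) y) := by
    rw [Complex.ofReal_mul, torusJacksonKernel_eq_sum, mul_sum]
    refine sum_congr rfl fun k _ => ?_
    rw [sub_eq_add_neg, mFourier_apply_add, mFourier_apply_neg]
    ring
  have : (volume : Measure (UnitAddTorus ι)).IsNegInvariant := Measure.pi.isNegInvariant _
  rw [← integral_sub_left_eq_self _ volume x]
  simp only [sub_sub_cancel]
  rw [← integral_complex_ofReal]
  simp only [hexpand]
  rw [integral_finsetSum _ fun k _ => integrable_of_continuous (by fun_prop)]
  refine sum_congr rfl fun k _ => ?_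
  rw [integral_const_mul]
  ring

theorem exists_trigonometric_approximation [DecidableEq ι] {α H : NNReal} (hα : α ≤ 1)
    {φ : C(UnitAddTorus ι, ℝ)} (hφ : HolderWith H α φ) (hM : 1 ≤ M) :
    ∃ c : (ι → ℤ) → ℂ, c 0 = ((∫ y, φ y : ℝ) : ℂ) ∧
      (∀ k, k ≠ 0 → ‖c k‖ ≤ H * ‖k‖ ^ (-(α : ℝ))) ∧
      ∀ x, ‖(φ x : ℂ) - ∑ k ∈ frequencyBox ι (2 * M), c k * mFourier k x‖
        ≤ (1 + Fintype.card ι) * (H * (M : ℝ) ^ (-(α : ℝ))) := by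
  refine ⟨fun k => (∏ i, jacksonCoeff M (k i)) * ∫ y, (φ y : ℂ) * mFourier (-k) y, ?_,
    fun k hk => ?_, fun x => ?_⟩
  · simp only [Pi.zero_apply, jacksonCoeff_zero hM, prod_const_one, one_mul, neg_zero,
      mFourier_zero, ContinuousMap.one_apply, mul_one]
    exact integral_complex_ofReal
  · rw [norm_mul, norm_prod]
    exact (mul_le_of_le_one_left (norm_nonneg _) (prod_le_one (fun _ _ => norm_nonneg _)
      fun i _ => norm_jacksonCoeff_le_one hM (k i))).trans (norm_integral_mul_mFourier_neg_le hφ hk)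
  · rw [← integral_sub_mul_torusJacksonKernel, ← Complex.ofReal_sub, Complex.norm_real,
      Real.norm_eq_abs]
    refine (abs_sub_integral_sub_mul_le hφ (by fun_prop) (torusJacksonKernel_nonneg M)
      (integral_torusJacksonKernel hM) x).trans ?_
    rw [mul_left_comm]
    exact mul_le_mul_of_nonneg_left (integral_mul_norm_rpow_le (by fun_prop)
      (torusJacksonKernel_nonneg M) (integral_torusJacksonKernel hM) (by exact_mod_cast hM)
      (integral_torusJacksonKernel_mul_norm_sq_le hM) α.coe_nonneg hα) H.coe_nonneg

end Approximation

section FrequencySums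

variable {ι : Type*} [Fintype ι] [DecidableEq ι]

theorem sum_Icc_one_div_max_le (R : ℕ) :
    ∑ n ∈ Icc (-(R : ℤ)) R, 1 / max 1 |(n : ℝ)| ≤ 4 + 2 * Real.log R := by
  have heven : Function.Even fun n : ℤ => 1 / max 1 |(n : ℝ)| := fun n => by simp
  have hharmonic : ∑ n ∈ range R, 1 / max 1 |(((n + 1 : ℕ) : ℤ) : ℝ)| = (harmonic R : ℝ) := by
    rw [harmonic, Rat.cast_sum]
    refine sum_congr rfl fun n _ => ?_
    push_cast
    rw [abs_of_pos (by positivity), max_eq_right (by linarith [Nat.cast_nonneg (α := ℝ) n]),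
      one_div]
  rw [sum_Icc_of_even_eq_range heven, sum_range_succ', hharmonic]
  have := harmonic_le_one_add_log R
  simp only [nsmul_eq_mul, Nat.cast_ofNat, Nat.cast_zero, Int.cast_zero, abs_zero]
  norm_num
  linarith

theorem sum_frequencyBox_one_div_max_le (R : ℕ) (i : ι) :
    ∑ k ∈ frequencyBox ι R, 1 / max 1 |(k i : ℝ)|
      ≤ (2 * R + 1) ^ (Fintype.card ι - 1) * (4 + 2 * Real.log R) := by
  have hfactor (k : ι → ℤ) : 1 / max 1 |(k i : ℝ)|
      = ∏ j, if j = i then 1 / max 1 |(k j : ℝ)| else 1 := by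
    rw [prod_ite_eq' univ i, if_pos (mem_univ i)]
  have hcard : ∑ _n ∈ Icc (-(R : ℤ)) R, (1 : ℝ) = 2 * R + 1 := by
    rw [sum_const, Int.card_Icc, nsmul_one, show ((R : ℤ) + 1 - -R).toNat = 2 * R + 1 by omega]
    push_cast
    rfl
  simp only [hfactor]
  rw [frequencyBox, ← prod_univ_sum (fun _ : ι => Icc (-(R : ℤ)) R)
    fun j n => if j = i then 1 / max 1 |(n : ℝ)| else 1, ← mul_prod_erase univ _ (mem_univ i),
    prod_congr rfl (g := fun _ => (2 * R + 1 : ℝ))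
      fun j hj => by simp only [if_neg (ne_of_mem_erase hj), hcard], prod_const,
    card_erase_of_mem (mem_univ i), card_univ, mul_comm]
  simp only [if_true]
  gcongr
  exact sum_Icc_one_div_max_le R

theorem four_add_two_mul_log_le_mul_rpow {x ε : ℝ} (hx : 1 ≤ x) (hε : 0 < ε) :
    4 + 2 * Real.log x ≤ (4 + 2 / ε) * x ^ ε := by
  have hlog := Real.log_le_rpow_div (zero_le_one.trans hx) hε
  have hone := Real.one_le_rpow hx hε.le
  have : 2 / ε * x ^ ε = 2 * (x ^ ε / ε) := by ring
  linarith

/-- Splitting off one factor `‖k‖⁻¹`, which is at most the inverse of any single nonzero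
coordinate, will reduce the sum over the box to a harmonic one. -/
theorem norm_rpow_le_of_mem_frequencyBox {R : ℕ} {θ : ℝ} (hθ : -1 ≤ θ) {k : ι → ℤ} (hk0 : k ≠ 0)
    (hk : k ∈ frequencyBox ι R) (i : ι) :
    ‖k‖ ^ θ ≤ (R : ℝ) ^ (1 + θ) * (1 / max 1 |(k i : ℝ)|) := by
  have hk1 := one_le_norm_of_ne_zero hk0
  have hki : max 1 |(k i : ℝ)| ≤ ‖k‖ :=
    max_le hk1 ((Int.norm_eq_abs (k i)).symm.trans_le (norm_le_pi_norm k i))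
  calc ‖k‖ ^ θ = ‖k‖ ^ (1 + θ) * (1 / ‖k‖) := by
        rw [Real.rpow_add (by linarith), Real.rpow_one]
        field_simp
    _ ≤ (R : ℝ) ^ (1 + θ) * (1 / max 1 |(k i : ℝ)|) := by
        gcongr
        · linarith
        · exact mem_frequencyBox.1 hk

theorem sum_frequencyBox_norm_rpow_le [Nonempty ι] {R : ℕ} (hR : 1 ≤ R) {θ ε : ℝ} (hθ : -1 ≤ θ)
    (hε : 0 < ε) :
    ∑ k ∈ (frequencyBox ι R).erase 0, ‖k‖ ^ θ
      ≤ 3 ^ Fintype.card ι * (4 + 2 / ε) * (R : ℝ) ^ (Fintype.card ι + θ + ε) := by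
  obtain ⟨i⟩ := ‹Nonempty ι›
  have hR' : (1 : ℝ) ≤ R := by exact_mod_cast hR
  have hcard : (R : ℝ) * (2 * R + 1) ^ (Fintype.card ι - 1)
      ≤ 3 ^ Fintype.card ι * R ^ Fintype.card ι := by
    obtain ⟨n, hn⟩ := Nat.exists_eq_succ_of_ne_zero (Fintype.card_pos_iff.2 ⟨i⟩).ne'
    rw [hn, Nat.succ_sub_one, ← mul_pow, pow_succ']
    gcongr <;> linarith
  calc ∑ k ∈ (frequencyBox ι R).erase 0, ‖k‖ ^ θ
      ≤ ∑ k ∈ frequencyBox ι R, (R : ℝ) ^ (1 + θ) * (1 / max 1 |(k i : ℝ)|) :=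
        (sum_le_sum fun k hk => norm_rpow_le_of_mem_frequencyBox hθ (ne_of_mem_erase hk)
          (mem_of_mem_erase hk) i).trans
            (sum_le_sum_of_subset_of_nonneg (erase_subset _ _) fun k _ _ => by positivity)
    _ ≤ (R : ℝ) ^ (1 + θ) *
        ((2 * R + 1) ^ (Fintype.card ι - 1) * ((4 + 2 / ε) * (R : ℝ) ^ ε)) := by
        rw [← mul_sum]
        gcongr
        exact (sum_frequencyBox_one_div_max_le R i).trans
          (by gcongr; exact four_add_two_mul_log_le_mul_rpow hR' hε)
    _ = R * (2 * R + 1) ^ (Fintype.card ι - 1) * ((4 + 2 / ε) * (R : ℝ) ^ (θ + ε)) := by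
        rw [Real.rpow_add (by positivity), Real.rpow_add (by positivity), Real.rpow_one]
        ring
    _ ≤ 3 ^ Fintype.card ι * R ^ Fintype.card ι * ((4 + 2 / ε) * (R : ℝ) ^ (θ + ε)) := by
        gcongr
    _ = _ := by
        rw [add_assoc, Real.rpow_add (by positivity) (Fintype.card ι : ℝ), Real.rpow_natCast]
        ring

end FrequencySums

section Equidistribution

open MeasureTheory UnitAddTorus

variable {ι : Type*} [Fintype ι] {α H : NNReal} {φ : C(UnitAddTorus ι, ℝ)}

theorem abs_sum_div_sub_integral_le [DecidableEq ι] (hα : α ≤ 1) (hφ : HolderWith H α φ) {M N : ℕ}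
    (hM : 1 ≤ M) (hN : 1 ≤ N) (u : ℕ → UnitAddTorus ι) :
    |(∑ n ∈ range N, φ (u n)) / N - ∫ y, φ y| ≤
      H * ((1 + Fintype.card ι) * (M : ℝ) ^ (-(α : ℝ)) + ∑ k ∈ (frequencyBox ι (2 * M)).erase 0,
        ‖k‖ ^ (-(α : ℝ)) * (‖∑ n ∈ range N, mFourier k (u n)‖ / N)) := by
  have hN0 : (0 : ℝ) < N := by exact_mod_cast hN
  obtain ⟨c, hc0, hck, happrox⟩ := exists_trigonometric_approximation hα hφ hM
  set B := frequencyBox ι (2 * M)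
  set S : (ι → ℤ) → ℂ := fun k => (∑ n ∈ range N, mFourier k (u n)) / N with hS
  have hS0 : S 0 = 1 := by
    simp only [hS, mFourier_zero, ContinuousMap.one_apply, sum_const, card_range, nsmul_one]
    exact div_self (by exact_mod_cast hN0.ne')
  have hmean : (∑ n ∈ range N, ∑ k ∈ B, c k * mFourier k (u n)) / N
      = ((∫ y, φ y : ℝ) : ℂ) + ∑ k ∈ B.erase 0, c k * S k := by
    have hzero : (0 : ι → ℤ) ∈ B := mem_frequencyBox.2 (by rw [norm_zero]; positivity)
    rw [sum_comm, sum_div, ← add_sum_erase B _ hzero, ← hc0]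
    simp only [← mul_sum, mul_div_assoc]
    rw [show (∑ n ∈ range N, mFourier 0 (u n)) / N = S 0 from rfl, hS0, mul_one]
  have hsplit : (((∑ n ∈ range N, φ (u n)) / N - ∫ y, φ y : ℝ) : ℂ)
      = (∑ n ∈ range N, ((φ (u n) : ℂ) - ∑ k ∈ B, c k * mFourier k (u n))) / N +
        ∑ k ∈ B.erase 0, c k * S k := by
    rw [sum_sub_distrib, sub_div, hmean]
    push_cast
    ring
  rw [← Real.norm_eq_abs, ← Complex.norm_real, hsplit, mul_add]
  refine (norm_add_le _ _).trans (add_le_add ?_ ?_)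
  · rw [norm_div, Complex.norm_natCast, div_le_iff₀ hN0, mul_left_comm]
    refine (norm_sum_le_of_le _ fun n _ => happrox _).trans_eq ?_
    rw [sum_const, card_range, nsmul_eq_mul, mul_comm]
  · rw [mul_sum]
    refine norm_sum_le_of_le _ fun k hk => ?_
    rw [norm_mul, ← mul_assoc, hS, norm_div, Complex.norm_natCast]
    gcongr
    exact hck k (ne_of_mem_erase hk)

theorem abs_sum_div_sub_integral_le_of_norm_sum_mFourier_le [Nonempty ι] (hα : α ≤ 1)
    (hφ : HolderWith H α φ) {M N : ℕ} (hM : 1 ≤ M) (hN : 1 ≤ N) {u : ℕ → UnitAddTorus ι}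
    {A δ ε : ℝ} (hA : 0 ≤ A) (hδ : 0 ≤ δ) (hε : 0 < ε)
    (hu : ∀ k, k ≠ 0 → ‖∑ n ∈ range N, mFourier k (u n)‖ / N ≤ A * (‖k‖ / N) ^ δ) :
    |(∑ n ∈ range N, φ (u n)) / N - ∫ y, φ y| ≤
      H * ((1 + Fintype.card ι) * (M : ℝ) ^ (-(α : ℝ)) + 3 ^ Fintype.card ι * (4 + 2 / ε) *
        (A * ((N : ℝ) ^ (-δ) * (2 * M : ℝ) ^ (Fintype.card ι + (δ - α) + ε)))) := by
  classical
  have hα' : (α : ℝ) ≤ 1 := hα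
  refine (abs_sum_div_sub_integral_le hα hφ hM hN u).trans ?_
  gcongr
  calc ∑ k ∈ (frequencyBox ι (2 * M)).erase 0,
        ‖k‖ ^ (-(α : ℝ)) * (‖∑ n ∈ range N, mFourier k (u n)‖ / N)
      ≤ ∑ k ∈ (frequencyBox ι (2 * M)).erase 0, A * (N : ℝ) ^ (-δ) * ‖k‖ ^ (δ - α) := by
        refine sum_le_sum fun k hk => ?_
        have hk0 : 0 < ‖k‖ := norm_pos_iff.2 (ne_of_mem_erase hk)
        refine (mul_le_mul_of_nonneg_left (hu k (ne_of_mem_erase hk)) (by positivity)).trans_eq ?_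
        rw [Real.div_rpow hk0.le (Nat.cast_nonneg N), Real.rpow_neg (Nat.cast_nonneg N),
          sub_eq_add_neg, Real.rpow_add hk0]
        ring
    _ ≤ A * (N : ℝ) ^ (-δ) * (3 ^ Fintype.card ι * (4 + 2 / ε) *
        ((2 * M : ℕ) : ℝ) ^ (Fintype.card ι + (δ - α) + ε)) := by
        rw [← mul_sum]
        gcongr
        exact sum_frequencyBox_norm_rpow_le (by omega) (by linarith) hε
    _ = _ := by
        push_cast
        ring

theorem rpow_neg_mul_two_mul_rpow_le {d δ α ε N M : ℝ} (hd : 1 ≤ d) (hδ : 0 < δ) (hδ1 : δ ≤ 1)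
    (hα0 : 0 ≤ α) (hα : α ≤ 1) (hε : 0 ≤ ε) (hN : 1 ≤ N) (hM : 0 ≤ M)
    (hMN : M ≤ 2 * N ^ (δ / (δ + d))) :
    N ^ (-δ) * (2 * M) ^ (d + (δ - α) + ε) ≤ 4 ^ (d + 1 + ε) * N ^ (ε - α * δ / (δ + d)) := by
  have hN0 : 0 < N := by linarith
  set ρ := δ / (δ + d) with hρ
  have hρ1 : ρ ≤ 1 := div_le_one_of_le₀ (by linarith) (by positivity)
  have hρd : ρ * (δ + d) = δ := div_mul_cancel₀ _ (by positivity)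
  calc N ^ (-δ) * (2 * M) ^ (d + (δ - α) + ε)
      ≤ N ^ (-δ) * (4 * N ^ ρ) ^ (d + (δ - α) + ε) := by
        have hbase : 2 * M ≤ 4 * N ^ ρ := by linarith
        gcongr
        linarith
    _ = 4 ^ (d + (δ - α) + ε) * N ^ (-δ + ρ * (d + (δ - α) + ε)) := by
        rw [Real.mul_rpow (by norm_num) (by positivity), ← Real.rpow_mul hN0.le,
          Real.rpow_add hN0]
        ring
    _ ≤ 4 ^ (d + 1 + ε) * N ^ (ε - α * δ / (δ + d)) := by
        gcongr
        · norm_num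
        · linarith
        · rw [mul_div_assoc, ← hρ]
          nlinarith

/-- The degree of the approximating trigonometric polynomial is taken to be about
`N ^ (δ / (δ + card ι))`, which balances the approximation error against the exponential sums. -/
theorem exists_abs_sum_div_sub_integral_le_of_norm_sum_mFourier_le (ι : Type*) [Fintype ι]
    [Nonempty ι] {ε : ℝ} (hε : 0 < ε) :
    ∃ C : ℝ, 0 < C ∧ ∀ α H : NNReal, α ≤ 1 → ∀ φ : C(UnitAddTorus ι, ℝ), HolderWith H α φ →
      ∀ δ ∈ Set.Ioc (0 : ℝ) 1, ∀ A : ℝ, 1 ≤ A → ∀ N : ℕ, 1 ≤ N → ∀ u : ℕ → UnitAddTorus ι,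
        (∀ k, k ≠ 0 → ‖∑ n ∈ range N, mFourier k (u n)‖ / N ≤ A * (‖k‖ / N) ^ δ) →
        |(∑ n ∈ range N, φ (u n)) / N - ∫ y, φ y| ≤
          C * A * H * (N : ℝ) ^ (ε - α * δ / (δ + Fintype.card ι)) := by
  let C₀ : ℝ := 3 ^ Fintype.card ι * (4 + 2 / ε) * 4 ^ ((Fintype.card ι : ℝ) + 1 + ε)
  refine ⟨1 + Fintype.card ι + C₀, by positivity, ?_⟩
  rintro α H hα φ hφ δ ⟨hδ, hδ1⟩ A hA N hN u hu
  have hN' : (1 : ℝ) ≤ N := by exact_mod_cast hN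
  set ρ := δ / (δ + Fintype.card ι) with hρ
  have hNρ : 1 ≤ (N : ℝ) ^ ρ := Real.one_le_rpow hN' (by positivity)
  let M := ⌈(N : ℝ) ^ ρ⌉₊
  have hM : 1 ≤ M := Nat.one_le_ceil_iff.2 (by linarith)
  have hM_le : (M : ℝ) ≤ 2 * (N : ℝ) ^ ρ := by
    linarith [Nat.ceil_lt_add_one (zero_le_one.trans hNρ)]
  set b : ℝ := (N : ℝ) ^ (ε - α * δ / (δ + Fintype.card ι))
  have happrox : (M : ℝ) ^ (-(α : ℝ)) ≤ A * b := by
    calc (M : ℝ) ^ (-(α : ℝ)) ≤ ((N : ℝ) ^ ρ) ^ (-(α : ℝ)) :=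
          Real.rpow_le_rpow_of_nonpos (by linarith) (Nat.le_ceil _) (by simp)
      _ = (N : ℝ) ^ (-(α * δ / (δ + Fintype.card ι))) := by
          rw [← Real.rpow_mul (by linarith), hρ]
          ring_nf
      _ ≤ b := Real.rpow_le_rpow_of_exponent_le hN' (by linarith)
      _ ≤ A * b := le_mul_of_one_le_left (by positivity) hA
  calc |(∑ n ∈ range N, φ (u n)) / N - ∫ y, φ y|
      ≤ H * ((1 + Fintype.card ι) * (M : ℝ) ^ (-(α : ℝ)) + 3 ^ Fintype.card ι * (4 + 2 / ε) *
        (A * ((N : ℝ) ^ (-δ) * (2 * M : ℝ) ^ (Fintype.card ι + (δ - α) + ε)))) :=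
        abs_sum_div_sub_integral_le_of_norm_sum_mFourier_le hα hφ hM hN (by linarith) hδ.le hε hu
    _ ≤ H * ((1 + Fintype.card ι) * (A * b) + 3 ^ Fintype.card ι * (4 + 2 / ε) *
        (A * (4 ^ ((Fintype.card ι : ℝ) + 1 + ε) * b))) := by
        refine mul_le_mul_of_nonneg_left (add_le_add ?_ ?_) H.coe_nonneg
        · gcongr
        · refine mul_le_mul_of_nonneg_left (mul_le_mul_of_nonneg_left ?_ (by linarith))
            (by positivity)
          exact rpow_neg_mul_two_mul_rpow_le (by exact_mod_cast Fintype.card_pos) hδ hδ1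
            α.coe_nonneg hα hε.le hN' (Nat.cast_nonneg M) hM_le
    _ = (1 + Fintype.card ι + C₀) * A * H * b := by ring

end Equidistribution

section BirkhoffAverages

variable {d : ℕ} {ε : ℝ}

theorem DC_antitone : Antitone DC := fun _ _ hγ ω hω k hk => le_trans (by gcongr) (hω k hk)

theorem exists_abs_birkhoffAverage_sub_integral_le (hd : 1 ≤ d) {γ : ℝ} (hγ : 0 < γ)
    (hε : 0 < ε) :
    ∃ C : ℝ, ∀ α H : NNReal, α ≤ 1 → ∀ φ : C(Torus d, ℝ), HolderWith H α φ →
      ∀ ω ∈ DC γ, ∀ N : ℕ, 1 ≤ N → ∀ x : Torus d,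
        |birkhoffAverage ℝ (skewMap d ω) φ N x - ∫ y, φ y| ≤
          C * H * (N : ℝ) ^ (ε - α * ((2 : ℝ) ^ (d - 1))⁻¹ / (((2 : ℝ) ^ (d - 1))⁻¹ + d)) := by
  have : Nonempty (Fin d) := ⟨⟨0, hd⟩⟩
  set κ : ℝ := ((d - 1 : ℕ) : ℝ) ^ 2 + 4
  have hκ : 0 < κ := by positivity
  set ε' := ε / (1 + κ) with hε'
  have hκε' : ε' + κ * ε' = ε := by rw [hε']; field_simp
  have hε'0 : 0 < ε' := by positivity
  obtain ⟨c, hc, hDC⟩ := exists_isDiophantine_of_mem_DC hγ hε'0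
  obtain ⟨A, hA, hsum⟩ := exists_norm_sum_mFourier_iterate_skewMap_le d hc hε'0
  obtain ⟨C, -, hC⟩ := exists_abs_sum_div_sub_integral_le_of_norm_sum_mFourier_le (Fin d) hε'0
  refine ⟨C * A, fun α H hα φ hφ ω hω N hN x => ?_⟩
  have hN' : (1 : ℝ) ≤ N := by exact_mod_cast hN
  set δ := ((2 : ℝ) ^ (d - 1))⁻¹
  have hδ : δ ∈ Set.Ioc (0 : ℝ) 1 :=
    ⟨by positivity, inv_le_one_of_one_le₀ (one_le_pow₀ one_le_two)⟩
  have hbound := hC α H hα φ hφ δ hδ (A * (N : ℝ) ^ (κ * ε'))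
    (one_le_mul_of_one_le_of_one_le hA (Real.one_le_rpow hN' (by positivity))) N hN
    (fun n => (skewMap d ω)^[n] x)
    fun k hk => (hsum ω (hDC ω hω) k hk x N hN).trans_eq (by ring)
  rw [birkhoffAverage, birkhoffSum, smul_eq_mul, ← div_eq_inv_mul]
  refine hbound.trans_eq ?_
  rw [Fintype.card_fin, ← hκε', add_sub_right_comm, Real.rpow_add (by positivity)]
  ring

end BirkhoffAverages

section VanishingExponent

variable {ι : Type*} {Ω : ℝ → Set ι} {a : ι → ℕ → ℝ} {b β : ι → ℝ}

theorem exists_tendsto_atTop_eventually_le_rpow (c : ℕ → ℝ) :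
    ∃ m : ℕ → ℕ, Tendsto m atTop atTop ∧
      ∀ᶠ N : ℕ in atTop, c (m N) ≤ (N : ℝ) ^ (1 / ((m N : ℝ) + 1)) := by
  classical
  set P : ℕ → ℕ → Prop := fun N m => c m ≤ (N : ℝ) ^ (1 / ((m : ℝ) + 1))
  have hlarge (m : ℕ) : ∀ᶠ N : ℕ in atTop, P N m :=
    ((tendsto_rpow_atTop (by positivity)).comp tendsto_natCast_atTop_atTop).eventually_ge_atTop
      (c m)
  have htend : Tendsto (fun N => Nat.findGreatest (P N) N) atTop atTop := by
    refine tendsto_atTop.2 fun m => ?_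
    filter_upwards [hlarge m, eventually_ge_atTop m] with N hN hmN
    exact Nat.le_findGreatest hmN hN
  refine ⟨_, htend, ?_⟩
  filter_upwards [htend.eventually_ge_atTop 1] with N hN
  exact Nat.findGreatest_of_ne_zero (P := P N) rfl (by omega)

/-- Diagonal argument: `η N` is twice an `ε` that tends to `0` so slowly that the constant
belonging to `γ = ε` and `ε` is at most `N ^ ε`. -/
theorem exists_tendsto_zero_le_rpow_of_forall_pos (hΩ : Antitone Ω) (hb : ∀ i, 0 ≤ b i)
    (h : ∀ γ > 0, ∀ ε > 0, ∃ C : ℝ, ∀ i ∈ Ω γ, ∀ N : ℕ, 1 ≤ N →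
      a i N ≤ C * b i * (N : ℝ) ^ (ε - β i)) :
    ∃ η : ℕ → ℝ, Tendsto η atTop (𝓝 0) ∧ ∀ γ > 0, ∃ C > 0, ∀ i ∈ Ω γ, ∀ N : ℕ, 1 ≤ N →
      a i N ≤ C * b i * (N : ℝ) ^ (-(β i - η N)) := by
  choose c hc using fun m : ℕ => h (1 / ((m : ℝ) + 1)) (by positivity) (1 / ((m : ℝ) + 1))
    (by positivity)
  obtain ⟨m, hm, hcm⟩ := exists_tendsto_atTop_eventually_le_rpow c
  set r : ℕ → ℝ := fun N => 1 / ((m N : ℝ) + 1)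
  have hr0 (N : ℕ) : 0 < r N := by positivity
  have hr : Tendsto r atTop (𝓝 0) := tendsto_one_div_add_atTop_nhds_zero_nat.comp hm
  refine ⟨fun N => 2 * r N, by simpa using hr.const_mul 2, fun γ hγ => ?_⟩
  obtain ⟨N₀, hN₀⟩ := eventually_atTop.1 (hcm.and (hr.eventually_le_const hγ))
  obtain ⟨C, hC⟩ := h γ hγ 1 one_pos
  refine ⟨1 + |C| * N₀, by positivity, fun i hi N hN => ?_⟩
  have hN' : (1 : ℝ) ≤ N := by exact_mod_cast hN
  have hbi := hb i
  suffices ∃ K ≤ 1 + |C| * N₀, a i N ≤ K * b i * (N : ℝ) ^ (-(β i - 2 * r N)) by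
    obtain ⟨K, hK, haK⟩ := this
    exact haK.trans (by gcongr)
  rcases le_or_gt N₀ N with hlarge | hsmall
  · obtain ⟨hcN, hrγ⟩ := hN₀ N hlarge
    refine ⟨1, le_add_of_nonneg_right (by positivity), ?_⟩
    calc a i N ≤ c (m N) * b i * (N : ℝ) ^ (r N - β i) := hc (m N) i (hΩ hrγ hi) N hN
      _ ≤ (N : ℝ) ^ r N * b i * (N : ℝ) ^ (r N - β i) := by gcongr
      _ = 1 * b i * (N : ℝ) ^ (-(β i - 2 * r N)) := by
        rw [show -(β i - 2 * r N) = r N + (r N - β i) by ring, Real.rpow_add (by linarith)]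
        ring
  · refine ⟨|C| * N₀, le_add_of_nonneg_left zero_le_one, ?_⟩
    calc a i N ≤ C * b i * (N : ℝ) ^ (1 - β i) := hC i hi N hN
      _ ≤ |C| * b i * (N₀ * (N : ℝ) ^ (-(β i - 2 * r N))) := by
        rw [sub_eq_add_neg, Real.rpow_add (by linarith), Real.rpow_one]
        gcongr
        · exact le_abs_self C
        · linarith [hr0 N]
      _ = |C| * N₀ * b i * (N : ℝ) ^ (-(β i - 2 * r N)) := by ring

end VanishingExponent

end SkewProduct

open SkewProduct Filter Topology in
theorem mainTheorem5_general (d : ℕ) (hd : 1 ≤ d) :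
    ∃ η : ℕ → ℝ, Tendsto η atTop (𝓝 0) ∧
      ∀ γ : ℝ, 0 < γ → ∃ C : ℝ, 0 < C ∧
        ∀ α H : NNReal, α ≤ 1 → ∀ φ : C(Torus d, ℝ), HolderWith H α φ →
        ∀ ω ∈ DC γ, ∀ N : ℕ, 1 ≤ N → ∀ x : Torus d,
          |birkhoffAverage ℝ (skewMap d ω) φ N x - ∫ y, φ y| ≤
            C * H * (N : ℝ) ^ (-((α : ℝ) * ((2 : ℝ) ^ (d - 1))⁻¹ /
              (((2 : ℝ) ^ (d - 1))⁻¹ + (d : ℝ)) - η N)) := by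
  obtain ⟨η, hη, hbound⟩ := exists_tendsto_zero_le_rpow_of_forall_pos
    (Ω := fun γ => {(α, H, φ, ω, _) : NNReal × NNReal × C(Torus d, ℝ) × UnitAddCircle × Torus d |
      α ≤ 1 ∧ HolderWith H α φ ∧ ω ∈ DC γ})
    (a := fun (_, _, φ, ω, x) N => |birkhoffAverage ℝ (skewMap d ω) φ N x - ∫ y, φ y|)
    (b := fun (_, H, _) => H)
    (β := fun (α, _) => α * ((2 : ℝ) ^ (d - 1))⁻¹ / (((2 : ℝ) ^ (d - 1))⁻¹ + d))
    (fun _ _ hγ _ hi => ⟨hi.1, hi.2.1, DC_antitone hγ hi.2.2⟩) (fun i => i.2.1.coe_nonneg)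
    fun γ hγ ε hε => by
      obtain ⟨C, hC⟩ := exists_abs_birkhoffAverage_sub_integral_le hd hγ hε
      exact ⟨C, fun ⟨α, H, φ, ω, x⟩ ⟨hα, hφ, hω⟩ N hN => hC α H hα φ hφ ω hω N hN x⟩
  refine ⟨η, hη, fun γ hγ => ?_⟩
  obtain ⟨C, hC0, hC⟩ := hbound γ hγ
  exact ⟨C, hC0, fun α H hα φ hφ ω hω N hN x => hC (α, H, φ, ω, x) ⟨hα, hφ, hω⟩ N hN⟩

theorem mainTheorem5 (d : ℕ) (hd : 2 ≤ d) :
    ∃ η : ℕ → ℝ, Filter.Tendsto η Filter.atTop (nhds 0) ∧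
      ∀ γ : ℝ, 0 < γ → ∃ C : ℝ, 0 < C ∧
        ∀ α : NNReal, 0 < α → α ≤ 1 →
        ∀ φ : C(SkewProduct.Torus d, ℝ), MemHolder α (φ : SkewProduct.Torus d → ℝ) →
        ∀ ω ∈ SkewProduct.DC γ, ∀ N : ℕ, 1 ≤ N → ∀ x : SkewProduct.Torus d,
          |birkhoffAverage ℝ (SkewProduct.skewMap d ω) φ N x - ∫ y, φ y| ≤
            C * SkewProduct.holderNorm α φ *
              (N : ℝ) ^ (-((α : ℝ) * ((2 : ℝ) ^ (d - 1))⁻¹ /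
                (((2 : ℝ) ^ (d - 1))⁻¹ + (d : ℝ)) - η N)) := by
  obtain ⟨η, hη, hbound⟩ := mainTheorem5_general d (by omega)
  refine ⟨η, hη, fun γ hγ => ?_⟩
  obtain ⟨C, hC0, hC⟩ := hbound γ hγ
  refine ⟨C, hC0, fun α _ hα φ hφ ω hω N hN x => ?_⟩
  refine (hC α (nnHolderNorm α φ) hα φ hφ.holderWith ω hω N hN x).trans ?_
  gcongr
  exact le_add_of_nonneg_left (norm_nonneg φ)
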